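/- Let $G\le \mathrm{GL}(2,\mathbb{C})$ be a nontrivial finite group generated by reflections of order $2$ (for example $G(2m,m,2)$, $G(m,m,2)$, $G_{12}$, $G_{13}$, $G_{22}$), let $H=G\cap \mathrm{SL}(2,\mathbb{C})$ and $A=G/H\cong\mathbb{Z}/2$. Let $Y=H\text{-}\mathrm{Hilb}(\mathbb{C}^2)$ be the $H$-orbit Hilbert scheme, i.e. the variety whose points are the $H$-invariant ideals $I\subseteq\mathbb{C}[x,y]$ such that $\mathbb{C}[x,y]/I$ is isomorphic to the regular representation $\mathbb{C}[H]$, with the Zariski topology of $\mathrm{Hilb}^{|H|}(\mathbb{C}^2)$. Let $\pi:Y\to\mathbb{C}^2/H=\mathrm{Spec}\,\mathbb{C}[x,y]^H$, $I\mapsto I\cap\mathbb{C}[x,y]^H$, be the Hilbert–Chow morphism, and let $N\subseteq Y$ be the non-exceptional part, i.e. the set of those $I$ that are not supported at the origin. The group $A$ acts on $Y$ by $gH\cdot I=g(I)$. Suppose that $f_1,f_2,f_3\in\mathbb{C}[x,y]^H$ are such that $A$ fixes $f_1$ and $f_2$ and sends $f_3$ to $-f_3$, and that the map $\mathbb{C}[u,v,w]\to\mathbb{C}[x,y]^H$,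 $u\mapsto f_1$, $v\mapsto f_2$, $w\mapsto f_3$, is surjective with kernel generated by $w^2+p(u,v)$, where $p\in\mathbb{C}[u,v]$; so $\mathbb{C}[x,y]^H\cong\mathbb{C}[f_1,f_2,f_3]/(f_3^2+p(f_1,f_2))$. Then: (1) The assignment $q\mapsto V(q(f_1,f_2))\subseteq \mathbb{C}^2/H$ is a bijection from the irreducible factors of $p$ in $\mathbb{C}[u,v]$, up to units, to the irreducible components of the ramification locus of $\mathbb{C}^2/H\to\mathbb{C}^2/G$. (2) The assignment $Z\mapsto\overline{\pi^{-1}(Z)\cap N}$ (closure in $Y$) is a bijection from the irreducible components of the ramification locus of $\mathbb{C}^2/H\to\mathbb{C}^2/G$ to those irreducible components $F$ of the fixed locus $Y^A$ with $F\cap N\neq\emptyset$; moreover $Z=\overline{\pi(F)}$ if $F$ is the component that corresponds to $Z$. -/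

import Mathlib

open MvPolynomial

noncomputable section

/-- The polynomial ring `ℂ[x, y]`, the coordinate ring of `ℂ²`. -/
abbrev PolyXY : Type := MvPolynomial (Fin 2) ℂ

/-- The standard left action of `GL(2, ℂ)` on `ℂ[x, y]`: `(g · f)(v) = f (g⁻¹ v)`. -/
def linAct (g : GL (Fin 2) ℂ) : PolyXY →ₐ[ℂ] PolyXY :=
  aeval fun i => ∑ j, C ((g⁻¹ : GL (Fin 2) ℂ).val i j) * X j

/-- The ring of invariants `ℂ[x, y]^K`, the coordinate ring of `ℂ²/K`. -/
def invariants (K : Subgroup (GL (Fin 2) ℂ)) : Subalgebra ℂ PolyXY where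
  carrier := {f | ∀ g ∈ K, linAct g f = f}
  mul_mem' := fun ha hb g hg => by rw [map_mul, ha g hg, hb g hg]
  add_mem' := fun ha hb g hg => by rw [map_add, ha g hg, hb g hg]
  algebraMap_mem' := fun r g _ => (linAct g).commutes r

lemma invariants_anti {K L : Subgroup (GL (Fin 2) ℂ)} (h : K ≤ L) :
    invariants L ≤ invariants K := fun _ hf g hg => hf g (h hg)

/-- `H = G ∩ SL(2, ℂ)`. -/
def slPart (G : Subgroup (GL (Fin 2) ℂ)) : Subgroup (GL (Fin 2) ℂ) :=
  G ⊓ (Matrix.GeneralLinearGroup.det : GL (Fin 2) ℂ →* ℂˣ).ker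

lemma slPart_le (G : Subgroup (GL (Fin 2) ℂ)) : slPart G ≤ G := inf_le_left

/-- A (complex) reflection of order two: its fixed space is a line. -/
def IsOrderTwoReflection (g : GL (Fin 2) ℂ) : Prop :=
  (g.val - 1).rank = 1 ∧ orderOf g = 2

/-- A nontrivial finite subgroup of `GL(2, ℂ)` generated by reflections of order two. -/
def IsOrderTwoReflectionGroup (G : Subgroup (GL (Fin 2) ℂ)) : Prop :=
  Finite G ∧ G ≠ ⊥ ∧ Subgroup.closure {g | g ∈ G ∧ IsOrderTwoReflection g} = G

/-- The ramification locus in `Spec S` of `Spec S → Spec R`. -/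
def ramificationLocus {R S : Type*} [CommRing R] [CommRing S] (φ : R →+* S) :
    Set (PrimeSpectrum S) :=
  letI := φ.toAlgebra
  (Algebra.unramifiedLocus R S)ᶜ

/-- The ramification locus of `ℂ²/H → ℂ²/G`, where `H = G ∩ SL(2, ℂ)`. -/
def quotientRamification (G : Subgroup (GL (Fin 2) ℂ)) :
    Set (PrimeSpectrum (invariants (slPart G))) :=
  ramificationLocus (Subalgebra.inclusion (invariants_anti (slPart_le G))).toRingHom

/-- The irreducible components of a subspace `S`, as subsets of the ambient space. -/
def componentsOf {X : Type*} [TopologicalSpace X] (S : Set X) : Set (Set X) :=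
  {Z | Maximal (fun T => IsIrreducible T ∧ T ⊆ S) Z}

/-- The (closed) points of the Hilbert scheme `Hilbⁿ(ℂ²)`: ideals of colength `n`. -/
def Hilb (n : ℕ) : Type :=
  {I : Ideal PolyXY // Module.Finite ℂ (PolyXY ⧸ I) ∧ Module.finrank ℂ (PolyXY ⧸ I) = n}

/-- The standard chart of `Hilbⁿ(ℂ²)` given by a finite set `M` of (exponents of) monomials:
the ideals `I` such that the monomials in `M` form a basis of `ℂ[x, y]/I`. -/
structure HilbChart (n : ℕ) (M : Finset (Fin 2 →₀ ℕ)) where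
  point : Hilb n
  linInd : LinearIndependent ℂ
    fun m : M => Ideal.Quotient.mk point.1 (monomial (m : Fin 2 →₀ ℕ) (1 : ℂ))
  span : ⊤ ≤ Submodule.span ℂ (Set.range
    fun m : M => Ideal.Quotient.mk point.1 (monomial (m : Fin 2 →₀ ℕ) (1 : ℂ)))

/-- The coordinates on a chart: the coefficients `c e m` in the relations
`xᵉ ≡ ∑ m ∈ M, c e m • xᵐ mod I`. -/
def HilbChart.coords {n : ℕ} {M : Finset (Fin 2 →₀ ℕ)} (I : HilbChart n M) :
    (Fin 2 →₀ ℕ) × M → ℂ :=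
  fun em => (Module.Basis.mk I.linInd I.span).repr
    (Ideal.Quotient.mk I.point.1 (monomial em.1 (1 : ℂ))) em.2

/-- The Zariski topology on a chart: the closed sets are the common zero sets of polynomials in
the coordinates. -/
instance (n : ℕ) (M : Finset (Fin 2 →₀ ℕ)) : TopologicalSpace (HilbChart n M) :=
  TopologicalSpace.induced (fun I => (MvPolynomial.pointToPoint I.coords :
    PrimeSpectrum (MvPolynomial ((Fin 2 →₀ ℕ) × M) ℂ))) inferInstance

/-- The Zariski topology on `Hilbⁿ(ℂ²)`, glued from the charts: a set is open (closed) if and only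
if its intersection with every chart is. -/
instance (n : ℕ) : TopologicalSpace (Hilb n) :=
  ⨆ M : Finset (Fin 2 →₀ ℕ), TopologicalSpace.coinduced
    (HilbChart.point : HilbChart n M → Hilb n) inferInstance

/-- The ideal `I` is invariant under `K` and `ℂ[x, y]/I` is isomorphic, as a `K`-module, to the
regular representation `ℂ[K]`. -/
def IsCluster (K : Subgroup (GL (Fin 2) ℂ)) (I : Ideal PolyXY) : Prop :=
  (∀ h ∈ K, I.map (linAct h) = I) ∧
  ∃ e : (PolyXY ⧸ I) ≃ₗ[ℂ] MonoidAlgebra ℂ K, ∀ (h : K) (f : PolyXY),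
    e (Ideal.Quotient.mk I (linAct h f)) =
      MonoidAlgebra.of ℂ K h * e (Ideal.Quotient.mk I f)

/-- The `K`-orbit Hilbert scheme `K-Hilb(ℂ²)` (its closed points), with the Zariski topology as a
subspace of `Hilbⁿ(ℂ²)`, `n = |K|`. -/
abbrev OrbitHilb (K : Subgroup (GL (Fin 2) ℂ)) : Type :=
  {I : Hilb (Nat.card K) // IsCluster K I.1}

/-- The ideal of `ℂ[x, y]` that a point of `K-Hilb(ℂ²)` is. -/
def OrbitHilb.ideal {K : Subgroup (GL (Fin 2) ℂ)} (I : OrbitHilb K) : Ideal PolyXY := I.1.1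

lemma IsCluster.isPrime_comap {K : Subgroup (GL (Fin 2) ℂ)} {I : Ideal PolyXY}
    (hI : IsCluster K I) : (I.comap (invariants K).val).IsPrime := by
  obtain ⟨-, e, he⟩ := hI
  have hfix : ∀ f ∈ invariants K, ∀ h : K,
      (e (Ideal.Quotient.mk I f)).coeff h = (e (Ideal.Quotient.mk I f)).coeff 1 := by
    intro f hf h
    have h1 := he h f
    rw [hf h h.2] at h1
    conv_lhs => rw [h1]
    simp
  have hne : e (Ideal.Quotient.mk I 1) ≠ 0 := by
    intro h0
    have h1 : (1 : PolyXY ⧸ I) = 0 := by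
      rw [← map_one (Ideal.Quotient.mk I)]
      exact e.map_eq_zero_iff.1 h0
    have h2 : e (e.symm 1) = 0 := by
      rw [← mul_one (e.symm 1), h1, mul_zero, map_zero]
    rw [e.apply_symm_apply] at h2
    exact one_ne_zero h2
  have hmu : (e (Ideal.Quotient.mk I 1)).coeff 1 ≠ 0 := by
    intro h0
    refine hne (MonoidAlgebra.coeff_injective (Finsupp.ext fun h => ?_))
    rw [hfix 1 (one_mem _) h, h0]
    rfl
  have key : ∀ f ∈ invariants K, ∃ c : ℂ, f - C c ∈ I := by
    intro f hf
    refine ⟨(e (Ideal.Quotient.mk I f)).coeff 1 / (e (Ideal.Quotient.mk I 1)).coeff 1, ?_⟩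
    rw [← Ideal.Quotient.eq_zero_iff_mem, ← e.map_eq_zero_iff, ← mul_one (C _), ← smul_eq_C_mul,
      map_sub, map_sub, ← Ideal.Quotient.mkₐ_eq_mk ℂ, map_smul, map_smul, sub_eq_zero]
    refine MonoidAlgebra.coeff_injective (Finsupp.ext fun h => ?_)
    simp only [MonoidAlgebra.coeff_smul, Finsupp.smul_apply, smul_eq_mul,
      Ideal.Quotient.mkₐ_eq_mk]
    rw [hfix f hf h, hfix 1 (one_mem _) h, div_mul_cancel₀ _ hmu]
  have hC : ∀ c : ℂ, C c ∈ I → c = 0 := by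
    intro c hc
    by_contra hc0
    have h1 : (1 : PolyXY) ∈ I := by
      have := I.mul_mem_left (C c⁻¹) hc
      rwa [← C_mul, inv_mul_cancel₀ hc0, C_1] at this
    apply hne
    rw [Ideal.Quotient.eq_zero_iff_mem.2 h1, map_zero]
  refine Ideal.isPrime_iff.2 ⟨?_, ?_⟩
  · intro h
    have h1 : (1 : invariants K) ∈ I.comap (invariants K).val := h ▸ Submodule.mem_top
    have h2 : (C 1 : PolyXY) ∈ I := by simpa using h1
    exact one_ne_zero (hC 1 h2)
  · intro f g hfg
    obtain ⟨c, hc⟩ := key f f.2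
    obtain ⟨d, hd⟩ := key g g.2
    have hfg' : (f : PolyXY) * g ∈ I := hfg
    have hcd : C (c * d) ∈ I := by
      have h1 : (C (c * d) : PolyXY) = (f : PolyXY) * (g : PolyXY) -
          ((f : PolyXY) - C c) * (g : PolyXY) - C c * ((g : PolyXY) - C d) := by
        rw [C_mul]; ring
      rw [h1]
      exact I.sub_mem (I.sub_mem hfg' (I.mul_mem_right _ hc)) (I.mul_mem_left _ hd)
    rcases mul_eq_zero.1 (hC _ hcd) with h | h
    · left
      simpa [h] using hc
    · right
      simpa [h] using hd

/-- The Hilbert-Chow morphism `K-Hilb(ℂ²) → ℂ²/K = Spec ℂ[x, y]^K`. It sends an ideal `I` to the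
(maximal) ideal `I ∩ ℂ[x, y]^K`, i.e. a cluster to the orbit that supports it. -/
def hilbertChow {K : Subgroup (GL (Fin 2) ℂ)} (I : OrbitHilb K) :
    PrimeSpectrum (invariants K) :=
  ⟨I.ideal.comap (invariants K).val, I.2.isPrime_comap⟩

/-- The open subset `N` of `K-Hilb(ℂ²)`, the complement of the exceptional locus: the clusters that
are not supported at the origin. -/
def nonExceptional (K : Subgroup (GL (Fin 2) ℂ)) : Set (OrbitHilb K) :=
  {I | I.ideal.radical ≠ Ideal.span {X 0, X 1}}

/-- The fixed locus of `A = G/H` acting on `Y = H-Hilb(ℂ²)`. The class of `g` sends an ideal `I` to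
`g · I`, which depends only on the class of `g`, since the points of `Y` are `H`-invariant. -/
def fixedLocus (G : Subgroup (GL (Fin 2) ℂ)) : Set (OrbitHilb (slPart G)) :=
  {I | ∀ g ∈ G, I.ideal.map (linAct g) = I.ideal}

end

/-! ### The linear action on polynomials and its invariants -/

open MvPolynomial

noncomputable section

/-! The finite group H lies in SL(2, ℂ), so it acts freely on ℂ² ∖ {0}. Comparing colengths, a
cluster not supported at the origin is exactly the ideal of a free orbit (`exists_orbitPoint_eq`).
Questions about N thus become questions about nonzero points of ℂ².

On the side of ℂ²/H, the invariants of G are the polynomials in f₁ and f₂, so ℂ²/H → ℂ²/G is the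
double cover w² + p = 0. Kähler differentials show that it ramifies exactly where f₃ = 0
(`ramificationLocus_eq_zeroLocus`). Since f₃² = -p(f₁, f₂), this locus is the union of the branches
V(q(f₁, f₂)) for the irreducible factors q of p. Each branch is irreducible, and its prime contains
r(f₁, f₂) only if q divides r (`exists_branch`), so no branch contains another.

On the side of Y, the elements of G outside H change the sign of f₃ and fix f₁ and f₂. As invariants
separate orbits, a free orbit is fixed by A exactly when f₃ vanishes on it (`mem_fixedLocus_iff`).
The preimage of a branch in N is irreducible, being the set of orbits of the nonzero points of an
irreducible curve in ℂ² (`isIrreducible_preimage_hilbertChow`); here the orbit map is Zariski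
continuous by Cramer's rule (`exists_eval_ne_zero_of_isOpen`). Because N is open and the fixed locus
is closed, the components that meet N are the closures of these preimages, and π recovers the
branches from them. Both families of components are therefore indexed by the factors of p. -/

lemma eval_linAct (g : GL (Fin 2) ℂ) (f : PolyXY) (v : Fin 2 → ℂ) :
    eval v (linAct g f) = eval ((g⁻¹ : GL (Fin 2) ℂ).val.mulVec v) f := by
  have h : (eval v : PolyXY →+* ℂ).comp (linAct g : PolyXY →+* PolyXY) =
      eval ((g⁻¹ : GL (Fin 2) ℂ).val.mulVec v) := by
    refine MvPolynomial.ringHom_ext (fun c => ?_) fun i => ?_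
    · simp [linAct]
    · fin_cases i <;> simp [linAct]
  exact congrArg (fun φ : PolyXY →+* ℂ => φ f) h

lemma mulVec_mulVec_GL (g h : GL (Fin 2) ℂ) (v : Fin 2 → ℂ) :
    g.val.mulVec (h.val.mulVec v) = (g * h).val.mulVec v := by
  rw [Matrix.mulVec_mulVec]; rfl

lemma inv_mulVec_mulVec (g : GL (Fin 2) ℂ) (v : Fin 2 → ℂ) :
    (g⁻¹).val.mulVec (g.val.mulVec v) = v := by
  rw [mulVec_mulVec_GL, inv_mul_cancel]; simp

lemma linAct_mul (g h : GL (Fin 2) ℂ) (f : PolyXY) :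
    linAct (g * h) f = linAct g (linAct h f) := by
  refine MvPolynomial.funext fun v => ?_
  rw [eval_linAct, eval_linAct, eval_linAct, mulVec_mulVec_GL, mul_inv_rev]

lemma linAct_one (f : PolyXY) : linAct 1 f = f := by
  refine MvPolynomial.funext fun v => ?_
  simp [eval_linAct]

lemma linAct_linAct_inv (g : GL (Fin 2) ℂ) (f : PolyXY) : linAct g (linAct g⁻¹ f) = f := by
  rw [← linAct_mul, mul_inv_cancel, linAct_one]

/-- The action of a subgroup of `GL(2, ℂ)` on `ℂ[x, y]` by ring automorphisms. -/
abbrev polyAction (K : Subgroup (GL (Fin 2) ℂ)) : MulSemiringAction K PolyXY where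
  smul k f := linAct k f
  one_smul f := linAct_one f
  mul_smul g h f := linAct_mul g h f
  smul_zero k := map_zero (linAct k)
  smul_add k := map_add (linAct k)
  smul_one k := map_one (linAct k)
  smul_mul k := map_mul (linAct k)

lemma invariants_isInvariant (K : Subgroup (GL (Fin 2) ℂ)) :
    letI := polyAction K
    Algebra.IsInvariant (invariants K) PolyXY K :=
  letI := polyAction K
  ⟨fun b hb => ⟨⟨b, fun g hg => hb ⟨g, hg⟩⟩, rfl⟩⟩

lemma invariants_isIntegral (K : Subgroup (GL (Fin 2) ℂ)) [Finite K] :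
    Algebra.IsIntegral (invariants K) PolyXY :=
  let := polyAction K
  have := invariants_isInvariant K
  Algebra.IsInvariant.isIntegral _ _ K

/-- The invariants of a finite group separate orbits. -/
lemma exists_eq_mulVec_of_eval_eq (K : Subgroup (GL (Fin 2) ℂ)) [Finite K] {v w : Fin 2 → ℂ}
    (h : ∀ f ∈ invariants K, eval v f = eval w f) : ∃ k ∈ K, w = k.val.mulVec v := by
  let := polyAction K
  have := invariants_isInvariant K
  have : SMulCommClass K (invariants K) PolyXY := ⟨fun k a f => by
    change linAct k ((a : PolyXY) * f) = a * linAct k f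
    rw [map_mul, a.2 k k.2]⟩
  have hmem : ∀ (u : Fin 2 → ℂ) f, f ∈ vanishingIdeal ℂ {u} ↔ eval u f = 0 := fun u f => by
    rw [mem_vanishingIdeal_singleton_iff, aeval_eq_eval]
  -- A finite group acts transitively on the primes over a given prime of the ring of invariants;
  -- this is applied to the maximal ideals of v and w.
  obtain ⟨k, hk⟩ := Algebra.IsInvariant.exists_smul_of_under_eq (invariants K) PolyXY K
    (vanishingIdeal ℂ {v}) (vanishingIdeal ℂ {w}) (by
      ext f
      rw [Ideal.under_def, Ideal.under_def, Ideal.mem_comap, Ideal.mem_comap]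
      change (f : PolyXY) ∈ _ ↔ (f : PolyXY) ∈ _
      rw [hmem, hmem, h f f.2])
  refine ⟨k, k.2, ?_⟩
  have key : ∀ f, eval v f = 0 → eval w (linAct k f) = 0 := fun f hf => by
    rw [← hmem, hk]
    exact Ideal.smul_mem_pointwise_smul k f _ ((hmem _ _).2 hf)
  have h2 : (k.1⁻¹).val.mulVec w = v := by
    ext i
    have := key (X i - C (v i)) (by simp)
    rw [eval_linAct] at this
    simpa [sub_eq_zero] using this
  rw [← h2]
  simpa using (inv_mulVec_mulVec (k.1⁻¹) w).symm

/-! ### Free orbits as clusters -/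

/-- Evaluation of polynomials on the orbit of a point. -/
def orbitEval (K : Subgroup (GL (Fin 2) ℂ)) (v : Fin 2 → ℂ) : PolyXY →ₐ[ℂ] (K → ℂ) :=
  AlgHom.pi fun k => aeval (k.1.val.mulVec v)

lemma orbitEval_apply (K : Subgroup (GL (Fin 2) ℂ)) (v : Fin 2 → ℂ) (f : PolyXY) (k : K) :
    orbitEval K v f k = eval (k.1.val.mulVec v) f := by
  simp [orbitEval, aeval_eq_eval]

/-- The ideal of the orbit of a point. -/
def orbitIdeal (K : Subgroup (GL (Fin 2) ℂ)) (v : Fin 2 → ℂ) : Ideal PolyXY :=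
  RingHom.ker (orbitEval K v)

lemma mem_orbitIdeal {K : Subgroup (GL (Fin 2) ℂ)} {v : Fin 2 → ℂ} {f : PolyXY} :
    f ∈ orbitIdeal K v ↔ ∀ k ∈ K, eval (k.val.mulVec v) f = 0 := by
  rw [orbitIdeal, RingHom.mem_ker, funext_iff]
  simp [orbitEval_apply]

lemma eval_mulVec_of_mem_invariants {K : Subgroup (GL (Fin 2) ℂ)} {f : PolyXY}
    (hf : f ∈ invariants K) {k : GL (Fin 2) ℂ} (hk : k ∈ K) (v : Fin 2 → ℂ) :
    eval (k.val.mulVec v) f = eval v f := by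
  have := eval_linAct k⁻¹ f v
  rw [hf _ (inv_mem hk), inv_inv] at this
  exact this.symm

lemma mem_orbitIdeal_of_mem_invariants {K : Subgroup (GL (Fin 2) ℂ)} {v : Fin 2 → ℂ} {f : PolyXY}
    (hf : f ∈ invariants K) : f ∈ orbitIdeal K v ↔ eval v f = 0 := by
  rw [mem_orbitIdeal]
  refine ⟨fun h => ?_, fun h k hk => by rw [eval_mulVec_of_mem_invariants hf hk, h]⟩
  simpa using h 1 (one_mem K)

/-- A finite group of matrices of determinant one acts freely on `ℂ² ∖ {0}`. -/
lemma eq_one_of_mulVec_eq {K : Subgroup (GL (Fin 2) ℂ)} [Finite K]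
    (hK : ∀ k ∈ K, k.val.det = 1) {k : GL (Fin 2) ℂ} (hk : k ∈ K) {v : Fin 2 → ℂ} (hv : v ≠ 0)
    (h : k.val.mulVec v = v) : k = 1 := by
  set A : Matrix (Fin 2) (Fin 2) ℂ := k.val with hA
  have hdet := hK k hk
  have hB : (A - 1).det = 0 := by
    refine Matrix.exists_mulVec_eq_zero_iff.1 ⟨v, hv, ?_⟩
    rw [Matrix.sub_mulVec, h, Matrix.one_mulVec, sub_self]
  -- Determinant 1 and eigenvalue 1 force trace 2, so A is unipotent by Cayley–Hamilton. Then Aⁿ = 1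
  -- + n(A - 1), and finite order forces A = 1 in characteristic zero.
  have hsq : (A - 1) * (A - 1) = 0 := by
    rw [Matrix.det_fin_two] at hB hdet
    simp at hB
    have ht : A 0 0 + A 1 1 = 2 := by linear_combination hdet - hB
    ext i j
    fin_cases i <;> fin_cases j <;> simp [Matrix.mul_apply]
    · linear_combination A 0 0 * ht - hdet
    · linear_combination A 0 1 * ht
    · linear_combination A 1 0 * ht
    · linear_combination A 1 1 * ht - hdet
  have hpow : ∀ n : ℕ, A ^ n = 1 + (n : ℂ) • (A - 1) := by
    intro n
    induction n with
    | zero => simp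
    | succ n ih =>
      have : A = 1 + (A - 1) := by abel
      rw [pow_succ, ih]
      nth_rw 2 [this]
      rw [mul_add, add_mul _ _ (A - 1), smul_mul_assoc, hsq]
      push_cast
      rw [add_smul]
      simp
      abel
  obtain ⟨n, hn, hn1⟩ := (isOfFinOrder_iff_pow_eq_one.1 (isOfFinOrder_of_finite (⟨k, hk⟩ : K)))
  have h1 : A ^ n = 1 := by
    have := congrArg (fun z : K => z.1.val) hn1
    simpa using this
  rw [hpow] at h1
  have h2 : A - 1 = 0 := by
    have h3 : (n : ℂ) • (A - 1) = 0 := by simpa using h1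
    exact (smul_eq_zero.1 h3).resolve_left (by exact_mod_cast hn.ne')
  exact Units.ext (sub_eq_zero.1 h2)

lemma mulVec_orbit_injective {K : Subgroup (GL (Fin 2) ℂ)} [Finite K]
    (hK : ∀ k ∈ K, k.val.det = 1) {v : Fin 2 → ℂ} (hv : v ≠ 0) :
    Function.Injective fun k : K => k.1.val.mulVec v := by
  intro a b hab
  have h1 : (a.1⁻¹ * b.1).val.mulVec v = v := by
    rw [← mulVec_mulVec_GL, ← show a.1.val.mulVec v = b.1.val.mulVec v from hab,
      inv_mulVec_mulVec]
  have := eq_one_of_mulVec_eq hK (mul_mem (inv_mem a.2) b.2) hv h1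
  exact Subtype.ext (inv_mul_eq_one.1 this)

/-- Polynomials interpolate arbitrary values on finitely many points. -/
lemma exists_eval_eq {ι σ k : Type*} [Finite ι] [Field k] {x : ι → σ → k}
    (hx : Function.Injective x) (c : ι → k) :
    ∃ f : MvPolynomial σ k, ∀ i, eval (x i) f = c i := by
  classical
  have := Fintype.ofFinite ι
  have h1 : ∀ i j, ∃ f : MvPolynomial σ k, i ≠ j → eval (x i) f = 1 ∧ eval (x j) f = 0 := by
    intro i j
    by_cases hij : i = j
    · exact ⟨0, fun h => (h hij).elim⟩
    · obtain ⟨s, hs⟩ := Function.ne_iff.1 (hx.ne hij)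
      refine ⟨C (x i s - x j s)⁻¹ * (X s - C (x j s)), fun _ => ?_⟩
      simp [inv_mul_cancel₀ (sub_ne_zero.2 hs)]
  choose f hf using h1
  refine ⟨∑ i, C (c i) * ∏ j ∈ Finset.univ.erase i, f i j, fun i => ?_⟩
  rw [map_sum, Finset.sum_eq_single i]
  · rw [map_mul, eval_C, map_prod, Finset.prod_eq_one, mul_one]
    intro j hj
    exact (hf i j (Finset.ne_of_mem_erase hj).symm).1
  · intro j _ hji
    rw [map_mul, map_prod, Finset.prod_eq_zero (i := i), mul_zero]
    · exact Finset.mem_erase.2 ⟨hji.symm, Finset.mem_univ _⟩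
    · exact (hf j i hji).2
  · simp

lemma orbitEval_surjective {K : Subgroup (GL (Fin 2) ℂ)} [Finite K]
    (hK : ∀ k ∈ K, k.val.det = 1) {v : Fin 2 → ℂ} (hv : v ≠ 0) :
    Function.Surjective (orbitEval K v) := fun c => by
  obtain ⟨f, hf⟩ := exists_eval_eq (mulVec_orbit_injective hK hv) c
  exact ⟨f, funext fun k => by rw [orbitEval_apply, hf]⟩

/-- The coordinate ring of a free orbit. -/
def orbitQuotientEquiv {K : Subgroup (GL (Fin 2) ℂ)} [Finite K]
    (hK : ∀ k ∈ K, k.val.det = 1) {v : Fin 2 → ℂ} (hv : v ≠ 0) :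
    (PolyXY ⧸ orbitIdeal K v) ≃ₐ[ℂ] (K → ℂ) :=
  Ideal.quotientKerAlgEquivOfSurjective (orbitEval_surjective hK hv)

lemma orbitQuotientEquiv_mk {K : Subgroup (GL (Fin 2) ℂ)} [Finite K]
    (hK : ∀ k ∈ K, k.val.det = 1) {v : Fin 2 → ℂ} (hv : v ≠ 0) (f : PolyXY) :
    orbitQuotientEquiv hK hv (Ideal.Quotient.mk _ f) = orbitEval K v f := rfl

lemma finite_quotient_orbitIdeal {K : Subgroup (GL (Fin 2) ℂ)} [Finite K]
    (hK : ∀ k ∈ K, k.val.det = 1) {v : Fin 2 → ℂ} (hv : v ≠ 0) :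
    Module.Finite ℂ (PolyXY ⧸ orbitIdeal K v) :=
  Module.Finite.equiv (orbitQuotientEquiv hK hv).symm.toLinearEquiv

lemma finrank_quotient_orbitIdeal {K : Subgroup (GL (Fin 2) ℂ)} [Finite K]
    (hK : ∀ k ∈ K, k.val.det = 1) {v : Fin 2 → ℂ} (hv : v ≠ 0) :
    Module.finrank ℂ (PolyXY ⧸ orbitIdeal K v) = Nat.card K := by
  have := Fintype.ofFinite K
  rw [(orbitQuotientEquiv hK hv).toLinearEquiv.finrank_eq, Module.finrank_fintype_fun_eq_card,
    Nat.card_eq_fintype_card]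

lemma orbitEval_linAct {K : Subgroup (GL (Fin 2) ℂ)} (v : Fin 2 → ℂ) (h k : K) (f : PolyXY) :
    orbitEval K v (linAct h f) k = orbitEval K v f (h⁻¹ * k) := by
  rw [orbitEval_apply, orbitEval_apply, eval_linAct, mulVec_mulVec_GL]; rfl

lemma map_linAct_le_iff {g : GL (Fin 2) ℂ} {I J : Ideal PolyXY} :
    I.map (linAct g) ≤ J ↔ ∀ f ∈ I, linAct g f ∈ J := Ideal.map_le_iff_le_comap

lemma map_linAct_eq {K : Subgroup (GL (Fin 2) ℂ)} {I : Ideal PolyXY}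
    (h : ∀ g ∈ K, ∀ f ∈ I, linAct g f ∈ I) {g : GL (Fin 2) ℂ} (hg : g ∈ K) :
    I.map (linAct g) = I := by
  refine le_antisymm (map_linAct_le_iff.2 (h g hg)) fun f hf => ?_
  rw [← linAct_linAct_inv g f]
  exact Ideal.mem_map_of_mem _ (h _ (inv_mem hg) f hf)

lemma linAct_mem_of_map_eq {g : GL (Fin 2) ℂ} {I : Ideal PolyXY} (h : I.map (linAct g) = I)
    {f : PolyXY} (hf : f ∈ I) : linAct g f ∈ I :=
  map_linAct_le_iff.1 h.le f hf

/-- The functions on a free orbit are the functions on K. Translating them by h corresponds to left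
multiplication by h in the group algebra. -/
lemma isCluster_orbitIdeal {K : Subgroup (GL (Fin 2) ℂ)} [Finite K]
    (hK : ∀ k ∈ K, k.val.det = 1) {v : Fin 2 → ℂ} (hv : v ≠ 0) : IsCluster K (orbitIdeal K v) := by
  refine ⟨fun h hh => map_linAct_eq (fun h hh f hf => ?_) hh,
    (orbitQuotientEquiv hK hv).toLinearEquiv.trans
      ((Finsupp.linearEquivFunOnFinite ℂ ℂ K).symm.trans
        (MonoidAlgebra.coeffLinearEquiv ℂ).symm), fun h f => ?_⟩
  · rw [mem_orbitIdeal] at hf ⊢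
    intro k hk
    rw [eval_linAct, mulVec_mulVec_GL]
    exact hf _ (mul_mem (inv_mem hh) hk)
  · refine MonoidAlgebra.coeff_injective (Finsupp.ext fun k => ?_)
    simp [orbitQuotientEquiv_mk, orbitEval_linAct]

/-- The free orbit of a nonzero point, as a point of the orbit Hilbert scheme. -/
def orbitPoint {K : Subgroup (GL (Fin 2) ℂ)} [Finite K]
    (hK : ∀ k ∈ K, k.val.det = 1) (v : {v : Fin 2 → ℂ // v ≠ 0}) : OrbitHilb K :=
  ⟨⟨orbitIdeal K v, finite_quotient_orbitIdeal hK v.2, finrank_quotient_orbitIdeal hK v.2⟩,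
    isCluster_orbitIdeal hK v.2⟩

lemma orbitPoint_ideal {K : Subgroup (GL (Fin 2) ℂ)} [Finite K]
    (hK : ∀ k ∈ K, k.val.det = 1) (v : {v : Fin 2 → ℂ // v ≠ 0}) :
    (orbitPoint hK v).ideal = orbitIdeal K v := rfl

lemma OrbitHilb.ext_ideal {K : Subgroup (GL (Fin 2) ℂ)} {I J : OrbitHilb K}
    (h : I.ideal = J.ideal) : I = J := Subtype.ext (Subtype.ext h)

lemma mem_span_X_iff {f : PolyXY} : f ∈ Ideal.span {X 0, X 1} ↔ eval (0 : Fin 2 → ℂ) f = 0 := by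
  rw [eval_zero]
  have h : (Ideal.span {X 0, X 1} : Ideal PolyXY) = Ideal.span (Set.range X) := by
    congr 1
    ext f
    simp [Fin.exists_fin_two, eq_comm]
  rw [h, ← Set.image_univ, mem_ideal_span_X_image, constantCoeff_eq]
  constructor
  · intro hf
    by_contra h0
    obtain ⟨i, -, hi⟩ := hf 0 (mem_support_iff.2 h0)
    exact hi rfl
  · intro hf m hm
    obtain ⟨i, hi⟩ := Finsupp.ne_iff.1 (show m ≠ 0 by rintro rfl; exact mem_support_iff.1 hm hf)
    exact ⟨i, Set.mem_univ _, hi⟩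

lemma orbitPoint_mem_nonExceptional {K : Subgroup (GL (Fin 2) ℂ)} [Finite K]
    (hK : ∀ k ∈ K, k.val.det = 1) (v : {v : Fin 2 → ℂ // v ≠ 0}) :
    orbitPoint hK v ∈ nonExceptional K := by
  intro h
  refine v.2 (funext fun i => ?_)
  have h1 : (X i : PolyXY) ∈ (orbitPoint hK v).ideal.radical := by
    rw [h, mem_span_X_iff]; simp
  obtain ⟨n, hn⟩ := h1
  have := mem_orbitIdeal.1 hn 1 (one_mem _)
  simp at this
  exact this.1

/-- Every non-exceptional cluster is a free orbit. -/
lemma exists_orbitPoint_eq {K : Subgroup (GL (Fin 2) ℂ)} [Finite K]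
    (hK : ∀ k ∈ K, k.val.det = 1) {I : OrbitHilb K} (hI : I ∈ nonExceptional K) :
    ∃ v, orbitPoint hK v = I := by
  have hne : I.ideal ≠ ⊤ := fun h => I.2.isPrime_comap.ne_top (by
    rw [show I.1.1 = ⊤ from h]; rfl)
  -- If the origin were the only zero of the ideal, the Nullstellensatz would make its radical the
  -- ideal of the origin.
  obtain ⟨v, hv0, hv⟩ : ∃ v : Fin 2 → ℂ, v ≠ 0 ∧ ∀ f ∈ I.ideal, eval v f = 0 := by
    by_contra! hcon
    refine hI ?_
    obtain ⟨M, hM, hIM⟩ := Ideal.exists_le_maximal _ hne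
    obtain ⟨w, rfl⟩ := isMaximal_iff_eq_vanishingIdeal_singleton.1 hM
    have hw : ∀ f ∈ I.ideal, eval w f = 0 := fun f hf => by
      have := (mem_vanishingIdeal_singleton_iff w f).1 (hIM hf)
      rwa [aeval_eq_eval] at this
    have hw0 : w = 0 := by
      by_contra h
      obtain ⟨f, hf, hf'⟩ := hcon w h
      exact hf' (hw f hf)
    subst hw0
    rw [← vanishingIdeal_zeroLocus_eq_radical (K := ℂ)]
    ext f
    rw [mem_span_X_iff, mem_vanishingIdeal_iff]
    constructor
    · intro h
      have := h 0 (fun q hq => by rw [aeval_eq_eval]; exact hw q hq)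
      rwa [aeval_eq_eval] at this
    · intro h x hx
      rcases eq_or_ne x 0 with rfl | hx0
      · rwa [aeval_eq_eval]
      · obtain ⟨q, hq, hq'⟩ := hcon x hx0
        refine (hq' ?_).elim
        have := hx q hq
        rwa [aeval_eq_eval] at this
  refine ⟨⟨v, hv0⟩, OrbitHilb.ext_ideal ?_⟩
  have hle : I.ideal ≤ orbitIdeal K v := fun f hf => mem_orbitIdeal.2 fun k hk => by
    have h1 := hv _ (linAct_mem_of_map_eq (I.2.1 _ (inv_mem hk)) hf)
    rwa [eval_linAct, inv_inv] at h1
  rw [orbitPoint_ideal]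
  refine le_antisymm (fun f hf => ?_) hle
  have : Module.Finite ℂ (PolyXY ⧸ I.ideal) := I.1.2.1
  have := finite_quotient_orbitIdeal hK hv0
  -- Both ideals have colength |K|, so the inclusion of one in the other is an equality.
  have hinj : Function.Injective (Ideal.Quotient.factorₐ ℂ hle).toLinearMap := by
    refine (LinearMap.injective_iff_surjective_of_finrank_eq_finrank ?_).2
      (Ideal.Quotient.factor_surjective hle)
    rw [finrank_quotient_orbitIdeal hK hv0]
    exact I.1.2.2
  rw [← Ideal.Quotient.eq_zero_iff_mem]
  apply hinj
  rw [map_zero]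
  exact Ideal.Quotient.eq_zero_iff_mem.2 hf

lemma hilbertChow_orbitPoint {K : Subgroup (GL (Fin 2) ℂ)} [Finite K]
    (hK : ∀ k ∈ K, k.val.det = 1) (v : {v : Fin 2 → ℂ // v ≠ 0}) (f : invariants K) :
    f ∈ (hilbertChow (orbitPoint hK v)).asIdeal ↔ eval v.1 f.1 = 0 :=
  mem_orbitIdeal_of_mem_invariants f.2

/-- The exceptional locus is the fibre of the Hilbert-Chow morphism over the origin. -/
lemma compl_nonExceptional {K : Subgroup (GL (Fin 2) ℂ)} [Finite K]
    (hK : ∀ k ∈ K, k.val.det = 1) :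
    (nonExceptional K)ᶜ = hilbertChow ⁻¹'
      PrimeSpectrum.zeroLocus {f : invariants K | eval (0 : Fin 2 → ℂ) f.1 = 0} := by
  ext I
  constructor
  · intro h f hf
    have h1 : I.ideal.radical = Ideal.span {X 0, X 1} := by
      by_contra h2
      exact h h2
    have h2 : (f : PolyXY) ∈ I.ideal.radical := by rwa [h1, mem_span_X_iff]
    obtain ⟨n, hn⟩ := h2
    exact (hilbertChow I).2.mem_of_pow_mem n hn
  · intro h hI
    obtain ⟨v, rfl⟩ := exists_orbitPoint_eq hK hI
    -- Each invariant f takes the same value at v as at the origin, because f - f(0) vanishes at v.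
    -- So v would lie in the orbit of the origin.
    obtain ⟨k, -, hk⟩ := exists_eq_mulVec_of_eval_eq K (v := 0) (w := v) fun f hf => by
      have h1 : (⟨f, hf⟩ - algebraMap ℂ _ (eval 0 f) : invariants K) ∈
          (hilbertChow (orbitPoint hK v)).asIdeal := h (by simp [algebraMap_eq])
      rw [hilbertChow_orbitPoint] at h1
      simp [algebraMap_eq, sub_eq_zero] at h1
      simpa using h1.symm
    exact v.2 (by simpa using hk)

/-! ### Closed conditions in the charts of the Hilbert scheme -/

section Charts

variable {n : ℕ} {M : Finset (Fin 2 →₀ ℕ)}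

lemma HilbChart.isClosed_iff {Z : Set (HilbChart n M)} :
    IsClosed Z ↔ ∃ s : Set (MvPolynomial ((Fin 2 →₀ ℕ) × M) ℂ),
      Z = {I | ∀ F ∈ s, eval I.coords F = 0} := by
  have key : ∀ s : Set (MvPolynomial ((Fin 2 →₀ ℕ) × M) ℂ),
      (fun I : HilbChart n M => (MvPolynomial.pointToPoint I.coords :
        PrimeSpectrum (MvPolynomial ((Fin 2 →₀ ℕ) × M) ℂ))) ⁻¹' PrimeSpectrum.zeroLocus s =
      {I | ∀ F ∈ s, eval I.coords F = 0} := fun s => by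
    ext I
    refine forall₂_congr fun F _ => ?_
    change F ∈ vanishingIdeal ℂ {I.coords} ↔ _
    rw [mem_vanishingIdeal_singleton_iff, aeval_eq_eval]
  rw [isClosed_induced_iff]
  constructor
  · rintro ⟨t, ht, rfl⟩
    obtain ⟨s, rfl⟩ := (PrimeSpectrum.isClosed_iff_zeroLocus t).1 ht
    exact ⟨s, key s⟩
  · rintro ⟨s, rfl⟩
    exact ⟨_, PrimeSpectrum.isClosed_zeroLocus s, key s⟩

lemma Hilb.isClosed_iff {Z : Set (Hilb n)} :
    IsClosed Z ↔ ∀ M, IsClosed ((HilbChart.point : HilbChart n M → Hilb n) ⁻¹' Z) := by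
  simp only [← isOpen_compl_iff, isOpen_iSup_iff, isOpen_coinduced, Set.preimage_compl]

/-- The basis of the quotient by an ideal in a chart. -/
def HilbChart.basis (I : HilbChart n M) : Module.Basis M ℂ (PolyXY ⧸ I.point.1) :=
  Module.Basis.mk I.linInd I.span

lemma HilbChart.basis_apply (I : HilbChart n M) (m : M) :
    I.basis m = Ideal.Quotient.mk I.point.1 (monomial m.1 1) :=
  Module.Basis.mk_apply _ _ _

lemma HilbChart.coords_apply (I : HilbChart n M) (e : Fin 2 →₀ ℕ) (m : M) :
    I.coords (e, m) = I.basis.repr (Ideal.Quotient.mk I.point.1 (monomial e 1)) m := rfl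

/-- The linear form in the chart coordinates that computes a coordinate of the class of `f`. -/
def chartForm (M : Finset (Fin 2 →₀ ℕ)) (f : PolyXY) (m : M) :
    MvPolynomial ((Fin 2 →₀ ℕ) × M) ℂ :=
  ∑ e ∈ f.support, C (coeff e f) * X (e, m)

lemma HilbChart.eval_chartForm (I : HilbChart n M) (f : PolyXY) (m : M) :
    eval I.coords (chartForm M f m) = I.basis.repr (Ideal.Quotient.mk I.point.1 f) m := by
  conv_rhs => rw [f.as_sum]
  rw [chartForm, map_sum, map_sum, map_sum, Finsupp.finsetSum_apply]
  refine Finset.sum_congr rfl fun e _ => ?_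
  have h : monomial e (coeff e f) = coeff e f • monomial e (1 : ℂ) := by simp [smul_monomial]
  rw [h, ← Ideal.Quotient.mkₐ_eq_mk ℂ, map_smul, map_smul, Finsupp.smul_apply]
  simp [HilbChart.coords_apply]

lemma HilbChart.mem_iff (I : HilbChart n M) (f : PolyXY) :
    f ∈ I.point.1 ↔ ∀ m, eval I.coords (chartForm M f m) = 0 := by
  rw [← Ideal.Quotient.eq_zero_iff_mem, ← I.basis.repr.map_eq_zero_iff, Finsupp.ext_iff]
  simp [HilbChart.eval_chartForm]

lemma HilbChart.mk_monomial (I : HilbChart n M) (e : Fin 2 →₀ ℕ) :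
    Ideal.Quotient.mk I.point.1 (monomial e 1) =
      Ideal.Quotient.mk I.point.1 (∑ m : M, C (I.coords (e, m)) * monomial m.1 1) := by
  rw [← I.basis.sum_repr (Ideal.Quotient.mk I.point.1 (monomial e 1)), map_sum]
  refine Finset.sum_congr rfl fun m _ => ?_
  rw [← smul_eq_C_mul, ← Ideal.Quotient.mkₐ_eq_mk ℂ, map_smul, Ideal.Quotient.mkₐ_eq_mk,
    HilbChart.basis_apply, HilbChart.coords_apply]

end Charts

lemma Hilb.isClosed_setOf_mem (n : ℕ) (f : PolyXY) : IsClosed {I : Hilb n | f ∈ I.1} :=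
  Hilb.isClosed_iff.2 fun M => HilbChart.isClosed_iff.2
    ⟨Set.range (chartForm M f), by
      ext I
      rw [Set.mem_ofPred_eq, Set.forall_mem_range]
      exact I.mem_iff f⟩

/-- In a chart the ideal is the linear span of the differences xᵉ - ∑ c e m • xᵐ. It suffices to
test stability on these, and the coordinates of their images are polynomials in the c e m. -/
lemma Hilb.isClosed_setOf_stable (n : ℕ) (φ : PolyXY →ₐ[ℂ] PolyXY) :
    IsClosed {I : Hilb n | ∀ f ∈ I.1, φ f ∈ I.1} := by
  refine Hilb.isClosed_iff.2 fun M => HilbChart.isClosed_iff.2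
    ⟨Set.range fun em : (Fin 2 →₀ ℕ) × M => chartForm M (φ (monomial em.1 1)) em.2 -
      ∑ m, X (em.1, m) * chartForm M (φ (monomial m.1 1)) em.2, ?_⟩
  ext I
  have hrepr : (∀ F ∈ Set.range fun em : (Fin 2 →₀ ℕ) × M =>
      chartForm M (φ (monomial em.1 1)) em.2 -
      ∑ m, X (em.1, m) * chartForm M (φ (monomial m.1 1)) em.2, eval I.coords F = 0) ↔
      ∀ e, φ (monomial e 1 - ∑ m : M, C (I.coords (e, m)) * monomial m.1 1) ∈ I.point.1 := by
    simp only [Set.forall_mem_range, Prod.forall]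
    refine forall_congr' fun e => ?_
    rw [I.mem_iff]
    refine forall_congr' fun m => ?_
    simp only [HilbChart.eval_chartForm, map_sub, map_sum, map_mul, eval_X]
    simp only [← algebraMap_eq, AlgHom.commutes, ← Algebra.smul_def, ← Ideal.Quotient.mkₐ_eq_mk ℂ,
      map_smul, Finsupp.sub_apply, Finsupp.finsetSum_apply, Finsupp.smul_apply, smul_eq_mul]
  rw [Set.mem_ofPred_eq, hrepr]
  constructor
  · intro h e
    refine h _ ?_
    rw [← Ideal.Quotient.eq_zero_iff_mem, map_sub, I.mk_monomial e, sub_self]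
  · intro h f hf
    -- The normal form with respect to the monomials in M. It kills the ideal, and by `h` the images
    -- of f and ρ f under φ agree modulo the ideal.
    let ρ : PolyXY →ₗ[ℂ] PolyXY := (Fintype.linearCombination ℂ
      (fun m : M => (monomial m.1 1 : PolyXY))) ∘ₗ (Finsupp.linearEquivFunOnFinite ℂ ℂ M).toLinearMap
      ∘ₗ I.basis.repr.toLinearMap ∘ₗ (Ideal.Quotient.mkₐ ℂ I.point.1).toLinearMap
    have hρ : (Ideal.Quotient.mkₐ ℂ I.point.1).toLinearMap ∘ₗ φ.toLinearMap =
        (Ideal.Quotient.mkₐ ℂ I.point.1).toLinearMap ∘ₗ φ.toLinearMap ∘ₗ ρ := by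
      refine (basisMonomials (Fin 2) ℂ).ext fun e => ?_
      have h1 := Ideal.Quotient.eq_zero_iff_mem.2 (h e)
      rw [map_sub, map_sub, sub_eq_zero] at h1
      simpa [ρ, Fintype.linearCombination_apply, smul_eq_C_mul, HilbChart.coords_apply] using h1
    have h2 := LinearMap.congr_fun hρ f
    have h3 : ρ f = 0 := by
      simp [ρ, Ideal.Quotient.eq_zero_iff_mem.2 hf]
    rw [← Ideal.Quotient.eq_zero_iff_mem]
    simpa [h3] using h2

lemma OrbitHilb.isClosed_setOf_mem (K : Subgroup (GL (Fin 2) ℂ)) (f : PolyXY) :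
    IsClosed {I : OrbitHilb K | f ∈ I.ideal} :=
  (Hilb.isClosed_setOf_mem _ f).preimage continuous_subtype_val

lemma continuous_hilbertChow (K : Subgroup (GL (Fin 2) ℂ)) :
    Continuous (hilbertChow : OrbitHilb K → PrimeSpectrum (invariants K)) := by
  refine continuous_iff_isClosed.2 fun t ht => ?_
  obtain ⟨s, rfl⟩ := (PrimeSpectrum.isClosed_iff_zeroLocus t).1 ht
  have : hilbertChow ⁻¹' PrimeSpectrum.zeroLocus s =
      ⋂ f ∈ s, {I : OrbitHilb K | (f : PolyXY) ∈ I.ideal} := by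
    ext I
    simp only [Set.mem_iInter]
    exact Iff.rfl
  rw [this]
  exact isClosed_biInter fun f _ => OrbitHilb.isClosed_setOf_mem K f

lemma isClosed_fixedLocus (G : Subgroup (GL (Fin 2) ℂ)) : IsClosed (fixedLocus G) := by
  have : fixedLocus G = ⋂ g ∈ G, {I : OrbitHilb (slPart G) | ∀ f ∈ I.1.1, linAct g f ∈ I.1.1} := by
    ext I
    simp only [Set.mem_iInter]
    exact ⟨fun h g hg f hf => linAct_mem_of_map_eq (h g hg) hf, fun h g hg => map_linAct_eq h hg⟩
  rw [this]
  exact isClosed_biInter fun g _ =>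
    (Hilb.isClosed_setOf_stable _ (linAct g)).preimage continuous_subtype_val

lemma isOpen_nonExceptional {K : Subgroup (GL (Fin 2) ℂ)} [Finite K]
    (hK : ∀ k ∈ K, k.val.det = 1) : IsOpen (nonExceptional K) := by
  rw [← isClosed_compl_iff, compl_nonExceptional hK]
  exact (PrimeSpectrum.isClosed_zeroLocus _).preimage (continuous_hilbertChow K)

/-- Every point of the Hilbert scheme lies in a chart. -/
lemma Hilb.exists_chart {n : ℕ} (I : Hilb n) :
    ∃ (M : Finset (Fin 2 →₀ ℕ)) (J : HilbChart n M), J.point = I := by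
  have := I.2.1
  obtain ⟨κ, a, ha, hspan, hind⟩ := exists_linearIndependent' ℂ
    (fun e : Fin 2 →₀ ℕ => Ideal.Quotient.mk I.1 (monomial e (1 : ℂ)))
  have := hind.finite
  have := Fintype.ofFinite κ
  let M : Finset (Fin 2 →₀ ℕ) := Finset.univ.map ⟨a, ha⟩
  have hM : ∀ m : M, ∃ k, a k = m := fun m => by
    obtain ⟨k, -, hk⟩ := Finset.mem_map.1 m.2
    exact ⟨k, hk⟩
  choose b hb using hM
  have hcomp : (fun m : M => Ideal.Quotient.mk I.1 (monomial (m : Fin 2 →₀ ℕ) (1 : ℂ))) =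
      ((fun e : Fin 2 →₀ ℕ => Ideal.Quotient.mk I.1 (monomial e (1 : ℂ))) ∘ a) ∘ b := by
    funext m; simp [hb]
  refine ⟨M, ⟨I, ?_, ?_⟩, rfl⟩
  · rw [hcomp]
    refine hind.comp b fun m m' h => Subtype.ext ?_
    rw [← hb, h, hb]
  · have hb' : Function.Surjective b := fun k =>
      ⟨⟨a k, by simp [M]⟩, ha (hb _)⟩
    rw [hcomp, hb'.range_comp, hspan]
    rintro x -
    obtain ⟨f, rfl⟩ := Ideal.Quotient.mk_surjective x
    rw [f.as_sum, map_sum]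
    refine sum_mem fun e _ => ?_
    have h : monomial e (coeff e f) = coeff e f • monomial e (1 : ℂ) := by simp [smul_monomial]
    rw [h, ← Ideal.Quotient.mkₐ_eq_mk ℂ, map_smul]
    exact Submodule.smul_mem _ _ (Submodule.subset_span ⟨e, rfl⟩)

/-! ### Zariski continuity of the orbit map -/

section OrbitCharts

variable {K : Subgroup (GL (Fin 2) ℂ)} {M : Finset (Fin 2 →₀ ℕ)} (e : M ≃ K)

/-- The values of monomials on the orbit of a generic point. -/
def orbitMatrix : Matrix M M PolyXY := fun i m => linAct (e i).1⁻¹ (monomial m.1 1)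

lemma eval_orbitMatrix (w : Fin 2 → ℂ) (i m : M) :
    eval w (orbitMatrix e i m) = orbitEval K w (monomial m.1 1) (e i) := by
  rw [orbitMatrix, eval_linAct, inv_inv, orbitEval_apply]

/-- The quotient by the orbit ideal embeds in the functions on K, so independence is that of the
columns of a square matrix of values. -/
lemma linearIndependent_orbitIdeal_iff (w : Fin 2 → ℂ) :
    LinearIndependent ℂ
      (fun m : M => Ideal.Quotient.mk (orbitIdeal K w) (monomial m.1 (1 : ℂ))) ↔
      eval w (orbitMatrix e).det ≠ 0 := by
  have h1 : (eval w (orbitMatrix e).det) = ((orbitMatrix e).map (eval w)).det :=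
    RingHom.map_det _ _
  rw [h1, ← isUnit_iff_ne_zero, ← Matrix.isUnit_iff_isUnit_det,
    ← Matrix.linearIndependent_cols_iff_isUnit]
  rw [Fintype.linearIndependent_iff, Fintype.linearIndependent_iff]
  refine forall_congr' fun c => imp_congr_left ?_
  have h2 : ∑ m, c m • Ideal.Quotient.mk (orbitIdeal K w) (monomial m.1 (1 : ℂ)) =
      Ideal.Quotient.mk (orbitIdeal K w) (∑ m, c m • monomial m.1 (1 : ℂ)) := by
    rw [map_sum]; rfl
  rw [h2, Ideal.Quotient.eq_zero_iff_mem, orbitIdeal, RingHom.mem_ker, map_sum, funext_iff,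
    funext_iff, e.forall_congr_left]
  refine forall_congr' fun k => ?_
  simp [eval_orbitMatrix, Matrix.col_apply]

/-- By Cramer's rule: the coordinates of an orbit solve a linear system whose matrix is the matrix
of values of the monomials. They are thus rational in w, with the determinant as denominator, and k
clears it. -/
lemma HilbChart.exists_eval_coords {n : ℕ} (F : MvPolynomial ((Fin 2 →₀ ℕ) × M) ℂ) :
    ∃ (k : ℕ) (q : PolyXY), ∀ (w : Fin 2 → ℂ) (J : HilbChart n M), J.point.1 = orbitIdeal K w →
      eval w (orbitMatrix e).det ^ k * eval J.coords F = eval w q := by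
  induction F using MvPolynomial.induction_on with
  | C a => exact ⟨0, C a, fun w J _ => by simp⟩
  | add F G hF hG =>
    obtain ⟨k, q, hq⟩ := hF
    obtain ⟨l, r, hr⟩ := hG
    refine ⟨k + l, (orbitMatrix e).det ^ l * q + (orbitMatrix e).det ^ k * r, fun w J hJ => ?_⟩
    rw [map_add, map_add, map_mul, map_mul, map_pow, map_pow, ← hq w J hJ, ← hr w J hJ]
    ring
  | mul_X F em hF =>
    obtain ⟨k, q, hq⟩ := hF
    let b : M → PolyXY := fun i => linAct (e i).1⁻¹ (monomial em.1 1)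
    refine ⟨k + 1, q * ((orbitMatrix e).adjugate.mulVec b) em.2, fun w J hJ => ?_⟩
    have hb : ((orbitMatrix e).map (eval w)).mulVec (fun m => J.coords (em.1, m)) =
        eval w ∘ b := by
      funext i
      have h1 := J.mk_monomial em.1
      rw [Ideal.Quotient.eq, hJ, mem_orbitIdeal] at h1
      have h2 := h1 _ (e i).2
      rw [map_sub, sub_eq_zero, map_sum] at h2
      simp only [Function.comp_apply, b, eval_linAct, inv_inv, h2, Matrix.mulVec, dotProduct]
      refine Finset.sum_congr rfl fun m _ => ?_
      rw [Matrix.map_apply, eval_orbitMatrix, orbitEval_apply, map_mul, eval_C, mul_comm]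
    have hD : eval w (orbitMatrix e).det * J.coords em =
        eval w (((orbitMatrix e).adjugate.mulVec b) em.2) := by
      have h3 : eval w (((orbitMatrix e).adjugate.mulVec b) em.2) =
          (((orbitMatrix e).map (eval w)).adjugate.mulVec (eval w ∘ b)) em.2 := by
        rw [show ((orbitMatrix e).map (eval w)).adjugate = (orbitMatrix e).adjugate.map (eval w)
          from ((eval w).map_adjugate (orbitMatrix e)).symm]
        exact (eval w).map_mulVec _ _ _
      rw [h3, ← hb, Matrix.mulVec_mulVec, Matrix.adjugate_mul, Matrix.smul_mulVec,
        Matrix.one_mulVec, show eval w (orbitMatrix e).det = ((orbitMatrix e).map (eval w)).det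
          from RingHom.map_det _ _]
      rfl
    rw [map_mul, map_mul, ← hq w J hJ, ← hD, eval_X]
    ring

end OrbitCharts

/-- The map that sends a nonzero point to its orbit is continuous in the Zariski topology. -/
lemma exists_eval_ne_zero_of_isOpen {K : Subgroup (GL (Fin 2) ℂ)} [Finite K]
    (hK : ∀ k ∈ K, k.val.det = 1) {U : Set (OrbitHilb K)} (hU : IsOpen U)
    {v : {v : Fin 2 → ℂ // v ≠ 0}} (hv : orbitPoint hK v ∈ U) :
    ∃ f : PolyXY, eval v.1 f ≠ 0 ∧
      ∀ w : {v : Fin 2 → ℂ // v ≠ 0}, eval w.1 f ≠ 0 → orbitPoint hK w ∈ U := by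
  obtain ⟨V, hV, rfl⟩ := isOpen_induced_iff.1 hU
  obtain ⟨M, J, hJ⟩ := Hilb.exists_chart (orbitPoint hK v).1
  have hJ' : J.point.1 = orbitIdeal K v := congrArg Subtype.val hJ
  have hcard : Nat.card M = Nat.card K := by
    rw [← J.point.2.2, Module.finrank_eq_nat_card_basis J.basis]
  have e : M ≃ K := (Finite.card_eq.1 hcard).some
  obtain ⟨s, hs⟩ := HilbChart.isClosed_iff.1 (Hilb.isClosed_iff.1 hV.isClosed_compl M)
  have hmem : ∀ J : HilbChart (Nat.card K) M, J.point ∉ V ↔ ∀ F ∈ s, eval J.coords F = 0 :=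
    fun J => Set.ext_iff.1 hs J
  have hJV : ¬ J.point ∉ V := by rw [hJ]; exact not_not.2 hv
  rw [hmem] at hJV
  push Not at hJV
  obtain ⟨F, hF, hFJ⟩ := hJV
  obtain ⟨k, q, hq⟩ := HilbChart.exists_eval_coords (n := Nat.card K) e F
  have hdet : eval v.1 (orbitMatrix e).det ≠ 0 := by
    rw [← linearIndependent_orbitIdeal_iff, ← hJ']
    exact J.linInd
  -- The determinant keeps the orbit of w inside the chart; the factor q keeps F nonzero there.
  refine ⟨(orbitMatrix e).det * q, ?_, fun w hw => ?_⟩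
  · rw [map_mul, ← hq v J hJ']
    exact mul_ne_zero hdet (mul_ne_zero (pow_ne_zero _ hdet) hFJ)
  · rw [map_mul] at hw
    have hind := (linearIndependent_orbitIdeal_iff e w.1).2 (left_ne_zero_of_mul hw)
    have := finite_quotient_orbitIdeal hK w.2
    let J' : HilbChart (Nat.card K) M := ⟨(orbitPoint hK w).1, hind,
      (hind.span_eq_top_of_card_eq_finrank' (by
        rw [finrank_quotient_orbitIdeal hK w.2, ← hcard, Nat.card_eq_fintype_card])).ge⟩
    have h1 : ¬ J'.point ∉ V := by
      rw [hmem]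
      intro h
      apply right_ne_zero_of_mul hw
      rw [← hq w J' rfl, h F hF, mul_zero]
    exact not_not.1 h1

/-! ### Irreducible families of orbits -/

/-- A polynomial outside the ideal of an irreducible variety of positive dimension does not vanish
at some nonzero point of it. -/
lemma exists_ne_zero_eval_ne_zero (P : Ideal PolyXY) [P.IsPrime] (hP : ¬ P.IsMaximal)
    {f : PolyXY} (hf : f ∉ P) : ∃ v : {v : Fin 2 → ℂ // v ≠ 0}, (∀ g ∈ P, eval v.1 g = 0) ∧
      eval v.1 f ≠ 0 := by
  obtain ⟨i, hi⟩ : ∃ i, (X i : PolyXY) ∉ P := by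
    by_contra! h
    refine hP ?_
    have h0 : vanishingIdeal ℂ {(0 : Fin 2 → ℂ)} ≤ P := fun g hg => by
      rw [mem_vanishingIdeal_singleton_iff, aeval_eq_eval, ← mem_span_X_iff] at hg
      exact Ideal.span_le.2 (by rintro _ (rfl | rfl) <;> exact h _) hg
    have hmax : (vanishingIdeal ℂ {(0 : Fin 2 → ℂ)}).IsMaximal := inferInstance
    rw [← hmax.eq_of_le (Ideal.IsPrime.ne_top') h0]
    exact hmax
  -- The extra factor X i excludes the origin from the points where the product is nonzero.
  have hfi : f * X i ∉ vanishingIdeal ℂ (zeroLocus ℂ P) := by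
    rw [IsPrime.vanishingIdeal_zeroLocus]
    exact fun h => (Ideal.IsPrime.mem_or_mem ‹_› h).elim hf hi
  simp only [mem_vanishingIdeal_iff, mem_zeroLocus_iff, aeval_eq_eval] at hfi
  push Not at hfi
  obtain ⟨v, hv, hvf⟩ := hfi
  simp only [map_mul, eval_X] at hvf
  exact ⟨⟨v, fun h => right_ne_zero_of_mul hvf (by simp [h])⟩, hv, left_ne_zero_of_mul hvf⟩

/-- The orbits of the nonzero points of an irreducible subvariety of `ℂ²` form an irreducible
subset. -/
lemma isIrreducible_image_orbitPoint {K : Subgroup (GL (Fin 2) ℂ)} [Finite K]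
    (hK : ∀ k ∈ K, k.val.det = 1) (P : Ideal PolyXY) [P.IsPrime] (hP : ¬ P.IsMaximal) :
    IsIrreducible (orbitPoint hK '' {v | ∀ f ∈ P, eval v.1 f = 0}) := by
  have key := fun f => exists_ne_zero_eval_ne_zero P hP (f := f)
  constructor
  · obtain ⟨v, hv, -⟩ := key 1 ((Ideal.ne_top_iff_one P).1 Ideal.IsPrime.ne_top')
    exact ⟨_, v, hv, rfl⟩
  · rintro U V hU hV ⟨_, ⟨u, hu, rfl⟩, huU⟩ ⟨_, ⟨v, hv, rfl⟩, hvV⟩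
    obtain ⟨f, hf, hfU⟩ := exists_eval_ne_zero_of_isOpen hK hU huU
    obtain ⟨g, hg, hgV⟩ := exists_eval_ne_zero_of_isOpen hK hV hvV
    obtain ⟨w, hw, hwfg⟩ := key (f * g) fun h =>
      (Ideal.IsPrime.mem_or_mem ‹_› h).elim (fun h => hf (hu f h)) (fun h => hg (hv g h))
    rw [map_mul] at hwfg
    exact ⟨_, ⟨w, hw, rfl⟩, hfU w (left_ne_zero_of_mul hwfg), hgV w (right_ne_zero_of_mul hwfg)⟩

/-! ### The double cover w² + p = 0 -/

section DoubleCover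

variable {S : Type*} [CommRing S] [Algebra ℂ S] {f₁ f₂ f₃ : S} {p : MvPolynomial (Fin 2) ℂ}

variable (f₁ f₂ f₃) in
lemma aeval_rename_castSucc (q : MvPolynomial (Fin 2) ℂ) :
    aeval ![f₁, f₂, f₃] (rename Fin.castSucc q) = aeval ![f₁, f₂] q := by
  rw [aeval_rename]
  congr 2
  ext i
  fin_cases i <;> rfl

lemma sq_eq_neg_aeval
    (hker : RingHom.ker (aeval ![f₁, f₂, f₃] : MvPolynomial (Fin 3) ℂ →ₐ[ℂ] S) =
      Ideal.span {X 2 ^ 2 + rename Fin.castSucc p}) : f₃ ^ 2 = -aeval ![f₁, f₂] p := by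
  have h : (X 2 ^ 2 + rename Fin.castSucc p : MvPolynomial (Fin 3) ℂ) ∈
      RingHom.ker (aeval ![f₁, f₂, f₃] : MvPolynomial (Fin 3) ℂ →ₐ[ℂ] S) := by
    rw [hker]; exact Ideal.mem_span_singleton_self _
  rw [RingHom.mem_ker, map_add, aeval_rename_castSucc] at h
  simp at h
  exact eq_neg_of_add_eq_zero_left h

lemma exists_eq_aeval_add_mul
    (hsurj : Function.Surjective (aeval ![f₁, f₂, f₃] : MvPolynomial (Fin 3) ℂ →ₐ[ℂ] S))
    (hker : RingHom.ker (aeval ![f₁, f₂, f₃] : MvPolynomial (Fin 3) ℂ →ₐ[ℂ] S) =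
      Ideal.span {X 2 ^ 2 + rename Fin.castSucc p}) (s : S) :
    ∃ a b : MvPolynomial (Fin 2) ℂ, s = aeval ![f₁, f₂] a + f₃ * aeval ![f₁, f₂] b := by
  obtain ⟨F, rfl⟩ := hsurj s
  induction F using MvPolynomial.induction_on with
  | C c => exact ⟨C c, 0, by simp⟩
  | add F G hF hG =>
    obtain ⟨a, b, h⟩ := hF
    obtain ⟨a', b', h'⟩ := hG
    exact ⟨a + a', b + b', by rw [map_add, h, h', map_add, map_add]; ring⟩
  | mul_X F i hF =>
    obtain ⟨a, b, h⟩ := hF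
    have hsq := sq_eq_neg_aeval hker
    fin_cases i
    · exact ⟨a * X 0, b * X 0, by simp [h]; ring⟩
    · exact ⟨a * X 1, b * X 1, by simp [h]; ring⟩
    · exact ⟨-(b * p), a, by simp [h]; linear_combination (aeval ![f₁, f₂] b) * hsq⟩

/-- Setting w = 0 turns w² + p into p, which vanishes modulo its divisor q, so this substitution
factors through S. -/
lemma exists_hom_quotient
    (hsurj : Function.Surjective (aeval ![f₁, f₂, f₃] : MvPolynomial (Fin 3) ℂ →ₐ[ℂ] S))
    (hker : RingHom.ker (aeval ![f₁, f₂, f₃] : MvPolynomial (Fin 3) ℂ →ₐ[ℂ] S) =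
      Ideal.span {X 2 ^ 2 + rename Fin.castSucc p})
    {q : MvPolynomial (Fin 2) ℂ} (hq : q ∣ p) :
    ∃ ε : S →+* MvPolynomial (Fin 2) ℂ ⧸ Ideal.span {q},
      (∀ r, ε (aeval ![f₁, f₂] r) = Ideal.Quotient.mk _ r) ∧ ε f₃ = 0 := by
  let ρ : MvPolynomial (Fin 3) ℂ →ₐ[ℂ] MvPolynomial (Fin 2) ℂ := aeval ![X 0, X 1, 0]
  have hρ : ∀ r, ρ (rename Fin.castSucc r) = r := fun r => by
    rw [aeval_rename_castSucc]
    have : (![X 0, X 1] : Fin 2 → MvPolynomial (Fin 2) ℂ) = X := by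
      ext i; fin_cases i <;> rfl
    rw [this, aeval_X_left_apply]
  have hle : RingHom.ker (aeval ![f₁, f₂, f₃] : MvPolynomial (Fin 3) ℂ →ₐ[ℂ] S).toRingHom ≤
      RingHom.ker ((Ideal.Quotient.mk (Ideal.span {q})).comp ρ.toRingHom) := by
    refine hker.le.trans ((Ideal.span_singleton_le_iff_mem _).2 ?_)
    rw [RingHom.mem_ker]
    change Ideal.Quotient.mk _ (ρ _) = 0
    rw [map_add, hρ, Ideal.Quotient.eq_zero_iff_mem, Ideal.mem_span_singleton]
    simpa [ρ] using hq
  refine ⟨RingHom.liftOfSurjective _ hsurj ⟨_, hle⟩, fun r => ?_, ?_⟩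
  · rw [← aeval_rename_castSucc f₁ f₂ f₃]
    refine (RingHom.liftOfRightInverse_comp_apply _ _ _ ⟨_, hle⟩ _).trans ?_
    exact congrArg _ (hρ r)
  · have h := RingHom.liftOfRightInverse_comp_apply _ _ (Function.rightInverse_surjInv hsurj)
      ⟨_, hle⟩ (X 2)
    have h3 : (aeval ![f₁, f₂, f₃]).toRingHom (X 2 : MvPolynomial (Fin 3) ℂ) = f₃ :=
      aeval_X _ 2
    exact (congrArg _ h3.symm).trans (h.trans (by simp [ρ]))

/-- The branch of the double cover `w² + p = 0` over the curve `q = 0`, where `q` is an irreducible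
factor of `p`. -/
lemma exists_branch
    (hsurj : Function.Surjective (aeval ![f₁, f₂, f₃] : MvPolynomial (Fin 3) ℂ →ₐ[ℂ] S))
    (hker : RingHom.ker (aeval ![f₁, f₂, f₃] : MvPolynomial (Fin 3) ℂ →ₐ[ℂ] S) =
      Ideal.span {X 2 ^ 2 + rename Fin.castSucc p})
    {q : MvPolynomial (Fin 2) ℂ} (hq : Irreducible q) (hqp : q ∣ p) :
    ∃ Q : PrimeSpectrum S, (∀ r, aeval ![f₁, f₂] r ∈ Q.asIdeal ↔ q ∣ r) ∧ f₃ ∈ Q.asIdeal ∧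
      PrimeSpectrum.zeroLocus {aeval ![f₁, f₂] q} = PrimeSpectrum.zeroLocus (Q.asIdeal : Set S) := by
  obtain ⟨ε, hε, hε3⟩ := exists_hom_quotient hsurj hker hqp
  have hprime : (Ideal.span {q}).IsPrime :=
    (Ideal.span_singleton_prime hq.ne_zero).2 hq.prime
  have hmem : ∀ r, aeval ![f₁, f₂] r ∈ RingHom.ker ε ↔ q ∣ r := fun r => by
    rw [RingHom.mem_ker, hε, Ideal.Quotient.eq_zero_iff_mem, Ideal.mem_span_singleton]
  refine ⟨⟨RingHom.ker ε, RingHom.ker_isPrime ε⟩, hmem, hε3, ?_⟩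
  ext P
  rw [PrimeSpectrum.mem_zeroLocus, PrimeSpectrum.mem_zeroLocus, Set.singleton_subset_iff]
  refine ⟨fun hP s hs => ?_, fun h => h ((hmem q).2 dvd_rfl)⟩
  have hdvd : ∀ r, q ∣ r → aeval ![f₁, f₂] r ∈ P.asIdeal := by
    rintro _ ⟨r, rfl⟩
    rw [map_mul]
    exact Ideal.mul_mem_right _ _ hP
  -- A prime containing q(f₁, f₂) contains p(f₁, f₂) = -f₃², and hence f₃.
  have h3 : f₃ ∈ P.asIdeal := P.2.mem_of_pow_mem 2 (by
    rw [sq_eq_neg_aeval hker]; exact neg_mem (hdvd p hqp))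
  obtain ⟨a, b, rfl⟩ := exists_eq_aeval_add_mul hsurj hker s
  refine add_mem (hdvd a ?_) (Ideal.mul_mem_right _ _ h3)
  rw [← hmem]
  have hs' : ε _ = 0 := hs
  rw [map_add, map_mul, hε3, zero_mul, add_zero] at hs'
  exact hs'

/-- The zero locus of `f₃` is covered by the branches. -/
lemma exists_factor_mem
    (hker : RingHom.ker (aeval ![f₁, f₂, f₃] : MvPolynomial (Fin 3) ℂ →ₐ[ℂ] S) =
      Ideal.span {X 2 ^ 2 + rename Fin.castSucc p})
    (hp : p ≠ 0) {P : Ideal S} [P.IsPrime] (hP : f₃ ∈ P) :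
    ∃ q, Irreducible q ∧ q ∣ p ∧ aeval ![f₁, f₂] q ∈ P := by
  have h1 : aeval ![f₁, f₂] p ∈ P := by
    rw [← neg_mem_iff, ← sq_eq_neg_aeval hker]
    exact Ideal.pow_mem_of_mem P hP 2 two_pos
  obtain ⟨s, hs, u, hu⟩ := UniqueFactorizationMonoid.exists_prime_factors p hp
  have h2 : aeval ![f₁, f₂] s.prod ∈ P := by
    have : aeval ![f₁, f₂] p * aeval ![f₁, f₂] (u⁻¹).val ∈ P := Ideal.mul_mem_right _ _ h1
    rw [← map_mul, ← hu, Units.mul_inv_cancel_right] at this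
    exact this
  rw [map_multiset_prod] at h2
  obtain ⟨q, hq, hqP⟩ := (Ideal.IsPrime.multiset_prod_mem_iff_exists_mem ‹_› _).1 h2
  obtain ⟨q, hqs, rfl⟩ := Multiset.mem_map.1 hq
  exact ⟨q, (hs q hqs).irreducible, (Multiset.dvd_prod hqs).trans (Dvd.intro _ hu), hqP⟩

lemma pderiv_rename_castSucc (a : MvPolynomial (Fin 2) ℂ) :
    pderiv 2 (rename Fin.castSucc a) = 0 := by
  refine pderiv_eq_zero_of_notMem_vars fun h => ?_
  obtain ⟨i, -, hi⟩ := Finset.mem_image.1 (vars_rename Fin.castSucc a h)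
  exact (Fin.castSucc_lt_last i).ne hi

/-- The w-derivative of (w² + p)G is 2wG + (w² + p)∂G, which maps into (f₃). Hence ∂/∂w descends to
a derivation from S to S/(f₃). -/
lemma mk_aeval_pderiv_eq_zero
    (hker : RingHom.ker (aeval ![f₁, f₂, f₃] : MvPolynomial (Fin 3) ℂ →ₐ[ℂ] S) =
      Ideal.span {X 2 ^ 2 + rename Fin.castSucc p}) {F : MvPolynomial (Fin 3) ℂ}
    (hF : aeval ![f₁, f₂, f₃] F = 0) :
    Ideal.Quotient.mk (Ideal.span {f₃}) (aeval ![f₁, f₂, f₃] (pderiv 2 F)) = 0 := by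
  rw [← RingHom.mem_ker, hker, Ideal.mem_span_singleton] at hF
  obtain ⟨G, rfl⟩ := hF
  have h := sq_eq_neg_aeval hker
  rw [Ideal.Quotient.eq_zero_iff_mem, Ideal.mem_span_singleton]
  refine ⟨2 * aeval ![f₁, f₂, f₃] G, ?_⟩
  simp only [Derivation.leibniz, map_add, pderiv_rename_castSucc, Derivation.leibniz_pow,
    pderiv_X_self, smul_eq_mul, map_mul, map_pow, aeval_rename_castSucc, aeval_X]
  simp
  linear_combination (aeval ![f₁, f₂, f₃] (pderiv 2 G)) * h

/-- The ramification locus of a double cover `w² + p = 0` is the zero locus of `w`. -/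
lemma ramificationLocus_eq_zeroLocus
    (hsurj : Function.Surjective (aeval ![f₁, f₂, f₃] : MvPolynomial (Fin 3) ℂ →ₐ[ℂ] S))
    (hker : RingHom.ker (aeval ![f₁, f₂, f₃] : MvPolynomial (Fin 3) ℂ →ₐ[ℂ] S) =
      Ideal.span {X 2 ^ 2 + rename Fin.castSucc p}) {R : Type*} [CommRing R] (φ : R →+* S)
    (hφ : (φ.range : Set S) = Set.range (aeval ![f₁, f₂] : MvPolynomial (Fin 2) ℂ →ₐ[ℂ] S)) :
    ramificationLocus φ = PrimeSpectrum.zeroLocus {f₃} := by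
  let := φ.toAlgebra
  have hR : ∀ r : R, ∃ a, aeval ![f₁, f₂] a = algebraMap R S r := fun r => by
    have : algebraMap R S r ∈ (φ.range : Set S) := ⟨r, rfl⟩
    rwa [hφ] at this
  have hR' : ∀ a : MvPolynomial (Fin 2) ℂ, ∃ r : R, algebraMap R S r = aeval ![f₁, f₂] a :=
    fun a => by
      have : aeval ![f₁, f₂] a ∈ (φ.range : Set S) := by rw [hφ]; exact ⟨a, rfl⟩
      exact this
  have hlocus : ramificationLocus φ = Module.support S (Ω[S⁄R]) := by
    rw [ramificationLocus, Algebra.unramifiedLocus_eq_compl_support, compl_compl]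
  rw [hlocus]
  ext P
  rw [PrimeSpectrum.mem_zeroLocus, Set.singleton_subset_iff]
  constructor
  · contrapose!
    intro hP
    rw [Module.notMem_support_iff']
    intro m
    refine ⟨f₃, hP, ?_⟩
    -- Differentiating f₃² = -p(f₁, f₂), whose right side comes from R, gives 2f₃ df₃ = 0. Since df₃
    -- generates the differentials, f₃ annihilates all of them.
    have h3 : f₃ • KaehlerDifferential.D R S f₃ = 0 := by
      obtain ⟨r, hr⟩ := hR' (-p)
      have h2 := congrArg (KaehlerDifferential.D R S) (sq_eq_neg_aeval hker)
      rw [← map_neg, ← hr, Derivation.map_algebraMap, Derivation.leibniz_pow] at h2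
      have h4 : (algebraMap ℂ S (1 / 2)) • (2 • f₃ ^ (2 - 1) • KaehlerDifferential.D R S f₃) =
          f₃ • KaehlerDifferential.D R S f₃ := by
        rw [← Nat.cast_smul_eq_nsmul S, smul_smul, ← map_natCast (algebraMap ℂ S), ← map_mul]
        simp
      rw [← h4, h2, smul_zero]
    have hm : m ∈ Submodule.span S (Set.range (KaehlerDifferential.D R S)) := by
      rw [KaehlerDifferential.span_range_derivation]; trivial
    induction hm using Submodule.span_induction with
    | mem x hx =>
      obtain ⟨s, rfl⟩ := hx
      obtain ⟨a, b, rfl⟩ := exists_eq_aeval_add_mul hsurj hker s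
      obtain ⟨r, hr⟩ := hR' a
      obtain ⟨t, ht⟩ := hR' b
      rw [← hr, ← ht, map_add, Derivation.leibniz, Derivation.map_algebraMap,
        Derivation.map_algebraMap, smul_zero, zero_add, zero_add, smul_comm, h3, smul_zero]
    | zero => exact smul_zero _
    | add x y _ _ hx hy => rw [smul_add, hx, hy, add_zero]
    | smul c x _ hx => rw [smul_comm, hx, smul_zero]
  · contrapose!
    intro hP h3
    rw [Module.notMem_support_iff'] at hP
    obtain ⟨s, hs, hs0⟩ := hP (KaehlerDifferential.D R S f₃)
    let d : MvPolynomial (Fin 3) ℂ → S ⧸ Ideal.span {f₃} := fun F =>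
      Ideal.Quotient.mk _ (aeval ![f₁, f₂, f₃] (pderiv 2 F))
    have hd : ∀ F G, aeval ![f₁, f₂, f₃] F = aeval ![f₁, f₂, f₃] G → d F = d G := fun F G h => by
      have := mk_aeval_pderiv_eq_zero (F := F - G) hker (by rw [map_sub, h, sub_self])
      rwa [map_sub, map_sub, map_sub, sub_eq_zero] at this
    have hsec := Function.surjInv_eq hsurj
    set σ := Function.surjInv hsurj
    -- This is ∂/∂w modulo f₃. It sends f₃ to 1, so any s that kills df₃ lies in (f₃), hence in P.
    let D : Derivation R S (S ⧸ Ideal.span {f₃}) := Derivation.mk'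
      { toFun := fun s => d (σ s)
        map_add' := fun s t => by
          rw [hd (σ (s + t)) (σ s + σ t) (by rw [map_add, hsec, hsec, hsec])]
          simp [d]
        map_smul' := fun r s => by
          obtain ⟨a, ha⟩ := hR r
          rw [hd (σ (r • s)) (rename Fin.castSucc a * σ s) (by
            rw [map_mul, hsec, hsec, aeval_rename_castSucc, ha, Algebra.smul_def])]
          simp only [d, Derivation.leibniz, pderiv_rename_castSucc, mul_zero, add_zero,
            smul_eq_mul, map_mul, aeval_rename_castSucc, ha, RingHom.id_apply, Algebra.smul_def]
          rfl } fun s t => by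
        change d (σ (s * t)) = s • d (σ t) + t • d (σ s)
        rw [hd (σ (s * t)) (σ s * σ t) (by rw [map_mul, hsec, hsec, hsec])]
        simp only [d, Derivation.leibniz, smul_eq_mul, map_mul, map_add, hsec, Algebra.smul_def]
        rfl
    have hD : D f₃ = 1 := by
      change d (σ f₃) = 1
      rw [hd (σ f₃) (X 2) (by rw [hsec]; simp)]
      simp [d]
    have h1 := congrArg D.liftKaehlerDifferential hs0
    rw [map_smul, Derivation.liftKaehlerDifferential_comp_D, hD, map_zero, Algebra.smul_def,
      mul_one] at h1
    have h2 : s ∈ Ideal.span {f₃} := Ideal.Quotient.eq_zero_iff_mem.1 h1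
    exact hs ((Ideal.span_singleton_le_iff_mem _).2 h3 h2)

end DoubleCover

/-! ### Preimages under the Hilbert–Chow morphism -/

/-- The ideal of an irreducible plane curve is not the ideal of a point. -/
lemma not_dvd_of_irreducible {q : MvPolynomial (Fin 2) ℂ} (hq : Irreducible q) (a b : ℂ) :
    ¬ (q ∣ X 0 - C a ∧ q ∣ X 1 - C b) := by
  rintro ⟨h0, h1⟩
  have hirr : Irreducible (X 0 - C a : MvPolynomial (Fin 2) ℂ) := by
    have hc : coeff (Finsupp.single 0 1) (X 0 - C a : MvPolynomial (Fin 2) ℂ) = 1 := by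
      rw [coeff_sub, coeff_C, if_neg (Finsupp.single_ne_zero.2 one_ne_zero).symm, sub_zero]
      exact coeff_X_same 0
    refine irreducible_of_totalDegree_eq_one ?_ fun x hx => ?_
    · refine le_antisymm ((totalDegree_sub _ _).trans (by simp)) ?_
      refine le_trans (by simp) (le_totalDegree (s := Finsupp.single 0 1) ?_)
      rw [mem_support_iff, hc]
      exact one_ne_zero
    · exact isUnit_of_dvd_one (hc ▸ hx (Finsupp.single 0 1))
  have h2 : (X 0 - C a : MvPolynomial (Fin 2) ℂ) ∣ X 1 - C b :=
    ((hq.associated_of_dvd hirr h0).symm.dvd).trans h1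
  -- The point (a, b + 1) is a zero of X 0 - a but not of X 1 - b.
  have h3 := map_dvd (eval ![a, b + 1]) h2
  simp at h3

lemma orbitIdeal_mulVec {K : Subgroup (GL (Fin 2) ℂ)} {k : GL (Fin 2) ℂ} (hk : k ∈ K)
    (v : Fin 2 → ℂ) : orbitIdeal K (k.val.mulVec v) = orbitIdeal K v := by
  ext f
  rw [mem_orbitIdeal, mem_orbitIdeal]
  constructor
  · intro h l hl
    have := h _ (mul_mem hl (inv_mem hk))
    rwa [mulVec_mulVec_GL, inv_mul_cancel_right] at this
  · intro h l hl
    rw [mulVec_mulVec_GL]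
    exact h _ (mul_mem hl hk)

lemma exists_prime_over {K : Subgroup (GL (Fin 2) ℂ)} [Finite K] (P : Ideal PolyXY)
    (Q : Ideal (invariants K)) [Q.IsPrime] (h : P.comap (algebraMap (invariants K) PolyXY) ≤ Q) :
    ∃ P' ≥ P, P'.IsPrime ∧ P'.comap (algebraMap (invariants K) PolyXY) = Q :=
  have := invariants_isIntegral K
  Ideal.exists_ideal_over_prime_of_isIntegral Q P h

lemma exists_prime_over_prime {K : Subgroup (GL (Fin 2) ℂ)} [Finite K]
    (Q : Ideal (invariants K)) [Q.IsPrime] :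
    ∃ P : Ideal PolyXY, P.IsPrime ∧ P.comap (algebraMap (invariants K) PolyXY) = Q := by
  obtain ⟨P, -, hP⟩ := exists_prime_over ⊥ Q (fun x hx => by
    have h0 : x = 0 := Subtype.ext ((Submodule.mem_bot _).1 (Ideal.mem_comap.1 hx))
    rw [h0]
    exact zero_mem Q)
  exact ⟨P, hP⟩

lemma mem_vanishingIdeal_singleton_iff_eval {σ k : Type*} [Field k] {v : σ → k}
    {f : MvPolynomial σ k} : f ∈ vanishingIdeal k {v} ↔ eval v f = 0 := by
  rw [mem_vanishingIdeal_singleton_iff, aeval_eq_eval]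

lemma exists_eq_comap_vanishingIdeal {K : Subgroup (GL (Fin 2) ℂ)} [Finite K]
    (P : Ideal PolyXY) [P.IsPrime]
    (h : (P.comap (algebraMap (invariants K) PolyXY)).IsMaximal) :
    ∃ v : Fin 2 → ℂ, P = vanishingIdeal ℂ {v} :=
  have := invariants_isIntegral K
  isMaximal_iff_eq_vanishingIdeal_singleton.1
    (Ideal.isMaximal_of_isIntegral_of_isMaximal_comap P h)

/-- A single prime P over Q suffices: by going up, each point of V(Q) lies under a point of V(P),
and points with the same image form one K-orbit. -/
lemma preimage_hilbertChow_inter_nonExceptional {K : Subgroup (GL (Fin 2) ℂ)} [Finite K]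
    (hK : ∀ k ∈ K, k.val.det = 1) (P : Ideal PolyXY) [P.IsPrime] (Q : Ideal (invariants K))
    (hPQ : P.comap (algebraMap (invariants K) PolyXY) = Q) :
    hilbertChow ⁻¹' PrimeSpectrum.zeroLocus (Q : Set (invariants K)) ∩ nonExceptional K =
      orbitPoint hK '' {v | ∀ f ∈ P, eval v.1 f = 0} := by
  have hint := invariants_isIntegral K
  apply Set.Subset.antisymm
  · rintro I ⟨hIQ, hIN⟩
    obtain ⟨w, rfl⟩ := exists_orbitPoint_eq hK hIN
    set m : Ideal (invariants K) :=
      (vanishingIdeal ℂ {w.1}).comap (algebraMap (invariants K) PolyXY) with hm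
    have hmem : ∀ f : invariants K, f ∈ m ↔ eval w.1 f.1 = 0 := fun f => by
      rw [hm, Ideal.mem_comap, mem_vanishingIdeal_singleton_iff_eval]; rfl
    have hmax : m.IsMaximal := Ideal.isMaximal_comap_of_isIntegral_of_isMaximal _
    obtain ⟨P', hPP', hP', hP'm⟩ := exists_prime_over P m (by
      rw [hPQ]
      intro f hf
      exact (hmem f).2 ((hilbertChow_orbitPoint hK w f).1 (hIQ hf)))
    obtain ⟨v, rfl⟩ := exists_eq_comap_vanishingIdeal P' (by rwa [hP'm])
    obtain ⟨k, hk, hwv⟩ := exists_eq_mulVec_of_eval_eq K (v := v) (w := w.1) fun f hf => by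
      have h1 : (⟨f, hf⟩ - algebraMap ℂ _ (eval w.1 f) : invariants K) ∈ m := by
        rw [hmem]; simp [algebraMap_eq]
      rw [← hP'm, Ideal.mem_comap, mem_vanishingIdeal_singleton_iff_eval] at h1
      have h2 : eval v (f - C (eval w.1 f)) = 0 := h1
      rwa [map_sub, eval_C, sub_eq_zero] at h2
    refine ⟨⟨v, fun h => w.2 (by rw [hwv, h, Matrix.mulVec_zero])⟩, fun f hf => ?_,
      OrbitHilb.ext_ideal ?_⟩
    · exact mem_vanishingIdeal_singleton_iff_eval.1 (hPP' hf)
    · exact ((congrArg (orbitIdeal K) hwv).trans (orbitIdeal_mulVec hk v)).symm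
  · rintro _ ⟨v, hv, rfl⟩
    refine ⟨fun f hf => ?_, orbitPoint_mem_nonExceptional hK v⟩
    change f ∈ (hilbertChow (orbitPoint hK v)).asIdeal
    rw [hilbertChow_orbitPoint]
    rw [← hPQ] at hf
    exact hv _ hf

/-- Both claims are transported from V(P) for a prime P over Q. As Q is not maximal, neither is P,
so removing the origin from V(P) leaves a dense subset. -/
lemma isIrreducible_preimage_hilbertChow {K : Subgroup (GL (Fin 2) ℂ)} [Finite K]
    (hK : ∀ k ∈ K, k.val.det = 1) (Q : Ideal (invariants K)) [Q.IsPrime] (hQ : ¬ Q.IsMaximal) :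
    IsIrreducible
      (hilbertChow ⁻¹' PrimeSpectrum.zeroLocus (Q : Set (invariants K)) ∩ nonExceptional K) ∧
    PrimeSpectrum.zeroLocus (Q : Set (invariants K)) ⊆ closure (hilbertChow ''
      (hilbertChow ⁻¹' PrimeSpectrum.zeroLocus (Q : Set (invariants K)) ∩ nonExceptional K)) := by
  have hint := invariants_isIntegral K
  obtain ⟨P, hP, hPQ⟩ := exists_prime_over_prime Q
  have hPmax : ¬ P.IsMaximal := fun h =>
    hQ (hPQ ▸ Ideal.isMaximal_comap_of_isIntegral_of_isMaximal P)
  rw [preimage_hilbertChow_inter_nonExceptional hK P Q hPQ]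
  refine ⟨isIrreducible_image_orbitPoint hK P hPmax, ?_⟩
  rw [← PrimeSpectrum.zeroLocus_vanishingIdeal_eq_closure]
  refine PrimeSpectrum.zeroLocus_anti_mono fun f hf => ?_
  by_contra hfQ
  have hfP : (f : PolyXY) ∉ P := fun h => hfQ (hPQ ▸ Ideal.mem_comap.2 h)
  obtain ⟨v, hv, hvf⟩ := exists_ne_zero_eval_ne_zero P hPmax hfP
  exact hvf ((hilbertChow_orbitPoint hK v f).1
    ((PrimeSpectrum.mem_vanishingIdeal _ _).1 hf _ ⟨_, ⟨v, hv, rfl⟩, rfl⟩))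

/-! ### Reflections, components and the fixed locus -/

lemma det_eq_one_of_mem_slPart {G : Subgroup (GL (Fin 2) ℂ)} (k : GL (Fin 2) ℂ)
    (hk : k ∈ slPart G) : k.val.det = 1 := by
  have h : Matrix.GeneralLinearGroup.det k = 1 := hk.2
  exact congrArg Units.val h

/-- A group generated by reflections of order two is not contained in `SL(2, ℂ)`. -/
lemma IsOrderTwoReflectionGroup.exists_notMem_slPart {G : Subgroup (GL (Fin 2) ℂ)}
    (hG : IsOrderTwoReflectionGroup G) : ∃ g ∈ G, g ∉ slPart G := by
  obtain ⟨hfin, hne, hgen⟩ := hG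
  obtain ⟨g, hg, hrank, hord⟩ : {g | g ∈ G ∧ IsOrderTwoReflection g}.Nonempty := by
    by_contra h
    rw [Set.not_nonempty_iff_eq_empty] at h
    rw [h, Subgroup.closure_empty] at hgen
    exact hne hgen.symm
  refine ⟨g, hg, fun hgH => ?_⟩
  have hfinH : Finite (slPart G) := Finite.of_injective _ (Subgroup.inclusion_injective (slPart_le G))
  have hdet : (g.val - 1).det = 0 := by
    by_contra h
    have := Matrix.rank_of_isUnit (g.val - 1)
      ((Matrix.isUnit_iff_isUnit_det _).2 (isUnit_iff_ne_zero.2 h))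
    rw [hrank] at this
    simp at this
  obtain ⟨v, hv, hgv⟩ := Matrix.exists_mulVec_eq_zero_iff.2 hdet
  rw [Matrix.sub_mulVec, Matrix.one_mulVec, sub_eq_zero] at hgv
  rw [eq_one_of_mulVec_eq det_eq_one_of_mem_slPart hgH hv hgv, orderOf_one] at hord
  exact absurd hord (by norm_num)

/-- The components of `B` with a monotone property, if they are given by a family that covers the
irreducible subsets with this property irredundantly. -/
lemma setOf_componentsOf_eq_range {X ι : Type*} [TopologicalSpace X] {B : Set X}
    {p : Set X → Prop} (hp : ∀ ⦃T T'⦄, T ⊆ T' → p T → p T') {V : ι → Set X}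
    (hirr : ∀ c, IsIrreducible (V c)) (hsub : ∀ c, V c ⊆ B) (hpV : ∀ c, p (V c))
    (hcov : ∀ T, IsIrreducible T → T ⊆ B → p T → ∃ c, T ⊆ V c)
    (hinj : ∀ c c', V c ⊆ V c' → c = c') : {F | F ∈ componentsOf B ∧ p F} = Set.range V := by
  apply Set.Subset.antisymm
  · rintro F ⟨hF, hpF⟩
    obtain ⟨c, hc⟩ := hcov F hF.1.1 hF.1.2 hpF
    exact ⟨c, (hF.2 ⟨hirr c, hsub c⟩ hc).antisymm hc⟩
  · rintro _ ⟨c, rfl⟩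
    refine ⟨⟨⟨hirr c, hsub c⟩, fun T hT hcT => ?_⟩, hpV c⟩
    obtain ⟨c', hc'⟩ := hcov T hT.1 hT.2 (hp hcT (hpV c))
    rwa [← hinj c c' (hcT.trans hc')] at hc'

section FixedLocus

variable {G : Subgroup (GL (Fin 2) ℂ)} {f₁ f₂ f₃ : invariants (slPart G)}

lemma linAct_aeval (hf₁ : ∀ g ∈ G, linAct g (f₁ : PolyXY) = f₁)
    (hf₂ : ∀ g ∈ G, linAct g (f₂ : PolyXY) = f₂) {g : GL (Fin 2) ℂ} (hg : g ∈ G)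
    (a : MvPolynomial (Fin 2) ℂ) :
    linAct g (aeval ![f₁, f₂] a : invariants (slPart G)) =
      (aeval ![f₁, f₂] a : invariants (slPart G)) := by
  have h : ((linAct g).comp (invariants (slPart G)).val).comp (aeval ![f₁, f₂]) =
      (invariants (slPart G)).val.comp (aeval ![f₁, f₂]) := by
    refine MvPolynomial.algHom_ext fun i => ?_
    fin_cases i
    · simpa using hf₁ g hg
    · simpa using hf₂ g hg
  exact DFunLike.congr_fun h a

/-- For g outside H, moving an orbit by g preserves f₁ and f₂ and negates f₃. These generate the
invariants, which separate orbits, so the orbit is fixed exactly when f₃ equals -f₃ on it. -/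
lemma mem_fixedLocus_iff [Finite (slPart G)] (hG : ∃ g ∈ G, g ∉ slPart G)
    {p : MvPolynomial (Fin 2) ℂ} (hf₁ : ∀ g ∈ G, linAct g (f₁ : PolyXY) = f₁)
    (hf₂ : ∀ g ∈ G, linAct g (f₂ : PolyXY) = f₂)
    (hf₃ : ∀ g ∈ G, g ∉ slPart G → linAct g (f₃ : PolyXY) = -f₃)
    (hsurj : Function.Surjective
      (aeval ![f₁, f₂, f₃] : MvPolynomial (Fin 3) ℂ →ₐ[ℂ] invariants (slPart G)))
    (hker : RingHom.ker
      (aeval ![f₁, f₂, f₃] : MvPolynomial (Fin 3) ℂ →ₐ[ℂ] invariants (slPart G)) =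
      Ideal.span {X 2 ^ 2 + rename Fin.castSucc p})
    {I : OrbitHilb (slPart G)} (hI : I ∈ nonExceptional (slPart G)) :
    I ∈ fixedLocus G ↔ f₃ ∈ (hilbertChow I).asIdeal := by
  obtain ⟨w, rfl⟩ := exists_orbitPoint_eq det_eq_one_of_mem_slPart hI
  rw [hilbertChow_orbitPoint]
  constructor
  · intro h
    obtain ⟨g, hg, hgH⟩ := hG
    set c := eval w.1 f₃.1 with hc
    -- The ideal contains f₃ - c, hence also its image -f₃ - c under g; evaluating at w gives -2c =
    -- 0.
    have h1 : (f₃.1 - C c) ∈ orbitIdeal (slPart G) w.1 := by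
      have : (f₃ - algebraMap ℂ _ c : invariants (slPart G)) ∈
          (hilbertChow (orbitPoint det_eq_one_of_mem_slPart w)).asIdeal := by
        rw [hilbertChow_orbitPoint]; simp [algebraMap_eq, hc]
      exact this
    have h2 : linAct g (f₃.1 - C c) ∈ orbitIdeal (slPart G) w.1 :=
      linAct_mem_of_map_eq (h g hg) h1
    rw [map_sub, hf₃ g hg hgH, ← algebraMap_eq, AlgHom.commutes] at h2
    have h3 := mem_orbitIdeal.1 h2 1 (one_mem _)
    simp [algebraMap_eq, ← hc] at h3
    have h4 : (-2 : ℂ) * c = 0 := by linear_combination h3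
    simpa using h4
  · intro h
    refine fun g hg => map_linAct_eq (K := G) (fun g hg f hf => ?_) hg
    replace hf : f ∈ orbitIdeal (slPart G) w.1 := hf
    change linAct g f ∈ orbitIdeal (slPart G) w.1
    rw [mem_orbitIdeal] at hf ⊢
    intro k hk
    rw [eval_linAct]
    set u := (g⁻¹).val.mulVec (k.val.mulVec w.1) with hu
    have h3 : eval u f₃.1 = 0 := by
      rw [hu, ← eval_linAct]
      by_cases hgH : g ∈ slPart G
      · rw [f₃.2 g hgH, eval_mulVec_of_mem_invariants f₃.2 hk, h]
      · rw [hf₃ g hg hgH, map_neg, eval_mulVec_of_mem_invariants f₃.2 hk, h, neg_zero]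
    obtain ⟨l, hl, hul⟩ := exists_eq_mulVec_of_eval_eq (slPart G) (v := w.1) (w := u)
      fun r hr => by
        obtain ⟨a, b, hab⟩ := exists_eq_aeval_add_mul hsurj hker ⟨r, hr⟩
        have hr' : r = (aeval ![f₁, f₂] a : invariants (slPart G)).1 +
            f₃.1 * (aeval ![f₁, f₂] b : invariants (slPart G)).1 := congrArg Subtype.val hab
        rw [hr', map_add, map_mul, map_add, map_mul, h, h3, zero_mul, zero_mul, add_zero,
          add_zero, hu, ← eval_linAct, linAct_aeval hf₁ hf₂ hg,
          eval_mulVec_of_mem_invariants (Subtype.prop _) hk]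
    rw [hul]
    exact hf l hl

/-- If a + f₃b is fixed by some g outside H, then comparing it with a - f₃b gives 2f₃b = 0. -/
lemma range_inclusion_invariants (hG : ∃ g ∈ G, g ∉ slPart G)
    {p : MvPolynomial (Fin 2) ℂ} (hf₁ : ∀ g ∈ G, linAct g (f₁ : PolyXY) = f₁)
    (hf₂ : ∀ g ∈ G, linAct g (f₂ : PolyXY) = f₂)
    (hf₃ : ∀ g ∈ G, g ∉ slPart G → linAct g (f₃ : PolyXY) = -f₃)
    (hsurj : Function.Surjective
      (aeval ![f₁, f₂, f₃] : MvPolynomial (Fin 3) ℂ →ₐ[ℂ] invariants (slPart G)))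
    (hker : RingHom.ker
      (aeval ![f₁, f₂, f₃] : MvPolynomial (Fin 3) ℂ →ₐ[ℂ] invariants (slPart G)) =
      Ideal.span {X 2 ^ 2 + rename Fin.castSucc p}) :
    ((Subalgebra.inclusion (invariants_anti (slPart_le G))).toRingHom.range :
      Set (invariants (slPart G))) =
      Set.range (aeval ![f₁, f₂] : MvPolynomial (Fin 2) ℂ →ₐ[ℂ] invariants (slPart G)) := by
  apply Set.Subset.antisymm
  · rintro _ ⟨r, rfl⟩
    obtain ⟨a, b, hab⟩ := exists_eq_aeval_add_mul hsurj hker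
      (Subalgebra.inclusion (invariants_anti (slPart_le G)) r)
    have hr : r.1 = (aeval ![f₁, f₂] a : invariants (slPart G)).1 +
        f₃.1 * (aeval ![f₁, f₂] b : invariants (slPart G)).1 := congrArg Subtype.val hab
    obtain ⟨g, hg, hgH⟩ := hG
    have h1 := r.2 g hg
    rw [hr, map_add, map_mul, linAct_aeval hf₁ hf₂ hg, linAct_aeval hf₁ hf₂ hg,
      hf₃ g hg hgH] at h1
    have h2 : (2 : PolyXY) * (f₃.1 * (aeval ![f₁, f₂] b : invariants (slPart G)).1) = 0 := by
      linear_combination -h1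
    rw [(mul_eq_zero.1 h2).resolve_left two_ne_zero, add_zero] at hr
    exact ⟨a, Subtype.ext hr.symm⟩
  · rintro _ ⟨a, rfl⟩
    exact ⟨⟨(aeval ![f₁, f₂] a : invariants (slPart G)).1, fun g hg => linAct_aeval hf₁ hf₂ hg a⟩,
      rfl⟩

end FixedLocus

/-! ### Matching the two families of components -/

/-- If p were 0, then f₃² = 0 would give f₃ = 0 in the domain S, placing w in the ideal (w²). -/
lemma ne_zero_of_ker_aeval_eq {S : Type*} [CommRing S] [IsDomain S] [Algebra ℂ S] {f₁ f₂ f₃ : S}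
    {p : MvPolynomial (Fin 2) ℂ}
    (hker : RingHom.ker (aeval ![f₁, f₂, f₃] : MvPolynomial (Fin 3) ℂ →ₐ[ℂ] S) =
      Ideal.span {X 2 ^ 2 + rename Fin.castSucc p}) : p ≠ 0 := by
  rintro rfl
  have h := sq_eq_neg_aeval hker
  rw [map_zero, neg_zero] at h
  have h3 : f₃ = 0 := eq_zero_of_pow_eq_zero h
  have hX : (X 2 : MvPolynomial (Fin 3) ℂ) ∈ RingHom.ker (aeval ![f₁, f₂, f₃] :
      MvPolynomial (Fin 3) ℂ →ₐ[ℂ] S) := by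
    rw [RingHom.mem_ker]; simpa using h3
  rw [hker, map_zero, add_zero, Ideal.mem_span_singleton] at hX
  obtain ⟨F, hF⟩ := hX
  have h1 : (1 : MvPolynomial (Fin 3) ℂ) = X 2 * F :=
    mul_left_cancel₀ (X_ne_zero 2) (by rw [mul_one]; linear_combination hF)
  have h2 := congrArg (eval 0) h1
  simp at h2

theorem mainTheorem10 (G : Subgroup (GL (Fin 2) ℂ)) (hG : IsOrderTwoReflectionGroup G)
    (f₁ f₂ f₃ : invariants (slPart G)) (p : MvPolynomial (Fin 2) ℂ)
    (hf₁ : ∀ g ∈ G, linAct g (f₁ : PolyXY) = f₁)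
    (hf₂ : ∀ g ∈ G, linAct g (f₂ : PolyXY) = f₂)
    (hf₃ : ∀ g ∈ G, g ∉ slPart G → linAct g (f₃ : PolyXY) = -f₃)
    (hsurj : Function.Surjective
      (MvPolynomial.aeval ![f₁, f₂, f₃] :
        MvPolynomial (Fin 3) ℂ →ₐ[ℂ] invariants (slPart G)))
    (hker : RingHom.ker
      (MvPolynomial.aeval ![f₁, f₂, f₃] :
        MvPolynomial (Fin 3) ℂ →ₐ[ℂ] invariants (slPart G)) =
      Ideal.span {MvPolynomial.X 2 ^ 2 + MvPolynomial.rename Fin.castSucc p}) :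
    ∃ (φ : {c : Associates (MvPolynomial (Fin 2) ℂ) // Irreducible c ∧ c ∣ Associates.mk p} ≃
        componentsOf (quotientRamification G))
      (ψ : componentsOf (quotientRamification G) ≃
        {F : Set (OrbitHilb (slPart G)) //
          F ∈ componentsOf (fixedLocus G) ∧ (F ∩ nonExceptional (slPart G)).Nonempty}),
      (∀ c, ∀ q : MvPolynomial (Fin 2) ℂ, Associates.mk q = c.1 →
        (φ c : Set (PrimeSpectrum (invariants (slPart G)))) =
          PrimeSpectrum.zeroLocus {MvPolynomial.aeval ![f₁, f₂] q}) ∧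
      (∀ Z, (ψ Z : Set (OrbitHilb (slPart G))) =
        closure (hilbertChow ⁻¹' Z.1 ∩ nonExceptional (slPart G))) ∧
      (∀ Z : componentsOf (quotientRamification G),
        (Z : Set (PrimeSpectrum (invariants (slPart G)))) =
        closure (hilbertChow '' (ψ Z).1)) := by
  have hGH := hG.exists_notMem_slPart
  have hfin := hG.1
  have hfinH : Finite (slPart G) :=
    Finite.of_injective _ (Subgroup.inclusion_injective (slPart_le G))
  have hK := det_eq_one_of_mem_slPart (G := G)
  have hp : p ≠ 0 := ne_zero_of_ker_aeval_eq hker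
  have hram : quotientRamification G = PrimeSpectrum.zeroLocus {f₃} :=
    ramificationLocus_eq_zeroLocus hsurj hker _
      (range_inclusion_invariants hGH hf₁ hf₂ hf₃ hsurj hker)
  have hfix := fun I (hI : I ∈ nonExceptional (slPart G)) =>
    mem_fixedLocus_iff hGH hf₁ hf₂ hf₃ hsurj hker hI
  have hcont := continuous_hilbertChow (slPart G)
  let ι := {c : Associates (MvPolynomial (Fin 2) ℂ) // Irreducible c ∧ c ∣ Associates.mk p}
  have hq' : ∀ c : ι, ∃ q, Associates.mk q = c.1 := fun c => Associates.mk_surjective c.1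
  choose q hq using hq'
  have hqirr : ∀ c, Irreducible (q c) := fun c => by
    rw [← Associates.irreducible_mk, hq]; exact c.2.1
  have hqdvd : ∀ c, q c ∣ p := fun c => by
    rw [← Associates.mk_dvd_mk, hq]; exact c.2.2
  choose Q hQ hQ3 hQlocus using fun c => exists_branch hsurj hker (hqirr c) (hqdvd c)
  -- If this prime were maximal, it would lie under a point v. Then q would divide every polynomial
  -- vanishing at (f₁(v), f₂(v)), in particular both linear forms through that point.
  have hQmax : ∀ c, ¬ (Q c).asIdeal.IsMaximal := fun c hmax => by
    obtain ⟨P, hP, hPQ⟩ := exists_prime_over_prime (Q c).asIdeal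
    obtain ⟨v, rfl⟩ := exists_eq_comap_vanishingIdeal P (by rwa [hPQ])
    have hmem : ∀ r, q c ∣ r ↔ eval v (aeval ![f₁, f₂] r : invariants (slPart G)).1 = 0 :=
      fun r => by
        rw [← hQ c r, ← hPQ, Ideal.mem_comap, mem_vanishingIdeal_singleton_iff_eval]; rfl
    refine not_dvd_of_irreducible (hqirr c) (eval v f₁.1) (eval v f₂.1) ⟨?_, ?_⟩
    · rw [hmem]; simp [algebraMap_eq]
    · rw [hmem]; simp [algebraMap_eq]
  let V : ι → Set (PrimeSpectrum (invariants (slPart G))) := fun c =>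
    PrimeSpectrum.zeroLocus ((Q c).asIdeal : Set _)
  let T : ι → Set (OrbitHilb (slPart G)) := fun c =>
    hilbertChow ⁻¹' V c ∩ nonExceptional (slPart G)
  have hVclosed : ∀ c, IsClosed (V c) := fun c => PrimeSpectrum.isClosed_zeroLocus _
  have hTirr := fun c => isIrreducible_preimage_hilbertChow hK (Q c).asIdeal (hQmax c)
  have hVirr : ∀ c, IsIrreducible (V c) := fun c =>
    (PrimeSpectrum.isIrreducible_zeroLocus_iff_of_radical _ (Q c).2.isRadical).2 (Q c).2
  have hVsub : ∀ c, V c ⊆ PrimeSpectrum.zeroLocus {f₃} := fun c P hP =>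
    Set.singleton_subset_iff.2 (hP (hQ3 c))
  have hVcov : ∀ A : Set (PrimeSpectrum (invariants (slPart G))), IsIrreducible A →
      A ⊆ PrimeSpectrum.zeroLocus {f₃} → ∃ c, A ⊆ V c := fun A hA hA3 => by
    have hprime := PrimeSpectrum.isIrreducible_iff_vanishingIdeal_isPrime.1 hA
    obtain ⟨r, hr, hrp, hrA⟩ := exists_factor_mem hker hp
      (P := PrimeSpectrum.vanishingIdeal A) ((PrimeSpectrum.mem_vanishingIdeal _ _).2
        fun x hx => hA3 hx rfl)
    let c : ι := ⟨Associates.mk r, Associates.irreducible_mk.2 hr, Associates.mk_dvd_mk.2 hrp⟩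
    refine ⟨c, fun x hx => ?_⟩
    have h1 : aeval ![f₁, f₂] (q c) ∈ x.asIdeal := by
      obtain ⟨s, hs⟩ := (Associates.mk_eq_mk_iff_associated.1 (hq c)).symm.dvd
      rw [hs, map_mul]
      exact Ideal.mul_mem_right _ _ ((PrimeSpectrum.mem_vanishingIdeal _ _).1 hrA x hx)
    have h2 : x ∈ PrimeSpectrum.zeroLocus {aeval ![f₁, f₂] (q c)} := Set.singleton_subset_iff.2 h1
    rwa [hQlocus] at h2
  have hVinj : ∀ c c', V c ⊆ V c' → c = c' := fun c c' h => by
    have h1 : Q c ∈ V c' := h (fun _ hx => hx)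
    have h2 : q c ∣ q c' := (hQ c _).1 (h1 ((hQ c' _).2 dvd_rfl))
    refine Subtype.ext ?_
    rw [← hq c, ← hq c']
    exact Associates.mk_eq_mk_iff_associated.2 ((hqirr c).associated_of_dvd (hqirr c') h2)
  -- The branch is recovered from the closure of its preimage. This gives the last assertion and
  -- transfers irredundancy from the branches to the components in Y.
  have hclosure : ∀ c, closure (hilbertChow '' closure (T c)) = V c := fun c => by
    apply Set.Subset.antisymm
    · refine closure_minimal (Set.image_subset_iff.2 ?_) (hVclosed c)
      exact closure_minimal Set.inter_subset_left ((hVclosed c).preimage hcont)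
    · exact (hTirr c).2.trans (closure_mono (Set.image_mono subset_closure))
  have hV := setOf_componentsOf_eq_range (B := quotientRamification G) (p := fun _ => True)
    (V := V) (fun _ _ _ _ => trivial) hVirr (by rwa [hram]) (fun _ => trivial)
    (by rw [hram]; exact fun A hA hA3 _ => hVcov A hA hA3) hVinj
  have hT := setOf_componentsOf_eq_range (B := fixedLocus G)
    (p := fun F => (F ∩ nonExceptional (slPart G)).Nonempty) (V := fun c => closure (T c))
    (fun _ _ h h' => h'.mono (Set.inter_subset_inter_left _ h))
    (fun c => (hTirr c).1.closure)
    (fun c => closure_minimal (fun I hI => (hfix I hI.2).2 (hVsub c hI.1 rfl))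
      (isClosed_fixedLocus G))
    (fun c => by
      obtain ⟨I, hI⟩ := (hTirr c).1.1
      exact ⟨I, subset_closure hI, hI.2⟩)
    (fun F hF hFfix hFN => by
      -- The open set N meets the irreducible set F, so F ∩ N is dense in F, and a branch containing
      -- π(F) then controls all of F.
      have hFcl : F ⊆ closure (F ∩ nonExceptional (slPart G)) := fun x hx => by
        refine mem_closure_iff.2 fun U hU hxU => ?_
        obtain ⟨y, hyF, hyU, hyN⟩ := hF.2 U _ hU (isOpen_nonExceptional hK) ⟨x, hx, hxU⟩ hFN
        exact ⟨y, hyU, hyF, hyN⟩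
      obtain ⟨c, hc⟩ := hVcov (hilbertChow '' F) (hF.image _ hcont.continuousOn)
        (Set.image_subset_iff.2 (hFcl.trans (closure_minimal
          (fun I hI => Set.singleton_subset_iff.2 ((hfix I hI.2).1 (hFfix hI.1)))
          ((PrimeSpectrum.isClosed_zeroLocus _).preimage hcont))))
      exact ⟨c, hFcl.trans (closure_mono fun I hI => ⟨hc ⟨I, hI.1, rfl⟩, hI.2⟩)⟩)
    (fun c c' h => hVinj c c' (by
      rw [← hclosure c, ← hclosure c']
      exact closure_mono (Set.image_mono h)))
  have hVinj' : Function.Injective V := fun c c' h => hVinj c c' h.subset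
  have hTinj' : Function.Injective fun c => closure (T c) := fun c c' h => by
    refine hVinj' ?_
    rw [← hclosure c, ← hclosure c']
    exact congrArg (fun A => closure (hilbertChow '' A)) h
  let φ : ι ≃ componentsOf (quotientRamification G) :=
    (Equiv.ofInjective V hVinj').trans (Equiv.setCongr (by rw [← hV]; simp))
  let χ : ι ≃ {F : Set (OrbitHilb (slPart G)) //
      F ∈ componentsOf (fixedLocus G) ∧ (F ∩ nonExceptional (slPart G)).Nonempty} :=
    (Equiv.ofInjective _ hTinj').trans (Equiv.setCongr hT.symm)
  have hφ : ∀ c, (φ c).1 = V c := fun c => rfl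
  have hψ : ∀ c, ((φ.symm.trans χ) (φ c)).1 = closure (T c) := fun c =>
    congrArg (fun c => (χ c).1) (φ.symm_apply_apply c)
  refine ⟨φ, φ.symm.trans χ, fun c r hr => ?_, fun Z => ?_, fun Z => ?_⟩
  · rw [hφ]
    change PrimeSpectrum.zeroLocus _ = _
    rw [← hQlocus]
    obtain ⟨u, hu⟩ := Associates.mk_eq_mk_iff_associated.1 ((hq c).trans hr.symm)
    have hspan : Ideal.span {(aeval ![f₁, f₂] (q c) : invariants (slPart G))} =
        Ideal.span {aeval ![f₁, f₂] r} := by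
      rw [← hu, map_mul]
      exact (Ideal.span_singleton_mul_right_unit (u.isUnit.map _) _).symm
    rw [← PrimeSpectrum.zeroLocus_span, hspan, PrimeSpectrum.zeroLocus_span]
  · obtain ⟨c, rfl⟩ := φ.surjective Z
    exact hψ c
  · obtain ⟨c, rfl⟩ := φ.surjective Z
    exact (hclosure c).symm.trans
      (congrArg (fun F => closure (hilbertChow '' F)) (hψ c).symm)

end
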